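/- **Theorem 1.** Let $n \ge 2$ and let $\rho \in M_2 \otimes M_n$ be a mixed quantum state, i.e. a positive semidefinite complex matrix with $\mathrm{tr}(\rho) = 1$. Let $\lambda_1 \ge \lambda_2 \ge \dots \ge \lambda_{2n} \ge 0$ be its eigenvalues, repeated according to multiplicity. The following are equivalent: 1. $\rho$ is *separable from spectrum*: for every unitary $U \in M_2 \otimes M_n$ the state $U^\dagger \rho U$ is separable, i.e. of the form $\sum_{i} p_i\, |v_i\rangle\langle v_i| \otimes |w_i\rangle\langle w_i|$ (a finite sum) with $p_i \ge 0$, $\sum_i p_i = 1$ and unit vectors $|v_i\rangle \in \mathbb{C}^2$, $|w_i\rangle \in \mathbb{C}^n$; 2. $\rho$ is *PPT from spectrum*: for every unitary $U \in M_2 \otimes M_n$ the partial transpose $(\mathrm{id}_2 \otimes T)(U^\dagger \rho U)$ is positive semidefinite, where $T$ is the transpose map on $M_n$; 3. $\lambda_1 \le \lambda_{2n-1} + 2\sqrt{\lambda_{2n-2}\,\lambda_{2n}}$. -/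

import Mathlib

open scoped Matrix Kronecker ComplexOrder

/-- Matrices in `M_m ⊗ M_n`, realised as complex matrices indexed by pairs, so that the elementary
tensor of `A ∈ M_m` and `B ∈ M_n` is the Kronecker product `A ⊗ₖ B`. -/
abbrev BipartiteMatrix (m n : ℕ) : Type := Matrix (Fin m × Fin n) (Fin m × Fin n) ℂ

/-- A mixed quantum state: a positive semidefinite matrix of trace one. -/
def IsState {m n : ℕ} (ρ : BipartiteMatrix m n) : Prop :=
  ρ.PosSemidef ∧ ρ.trace = 1

/-- A pure state: a vector of Euclidean length one. -/
def IsPure {d : ℕ} (v : Fin d → ℂ) : Prop := star v ⬝ᵥ v = 1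

/-- The rank-one operator `|v⟩⟨v|`. -/
def ketbra {d : ℕ} (v : Fin d → ℂ) : Matrix (Fin d) (Fin d) ℂ := Matrix.vecMulVec v (star v)

/-- Separability: `ρ` is a finite convex combination of pure product states. -/
def IsSeparableState {m n : ℕ} (ρ : BipartiteMatrix m n) : Prop :=
  ∃ (k : ℕ) (p : Fin k → ℝ) (v : Fin k → Fin m → ℂ) (w : Fin k → Fin n → ℂ),
    (∀ i, 0 ≤ p i) ∧ (∀ i, IsPure (v i)) ∧ (∀ i, IsPure (w i)) ∧ ∑ i, p i = 1 ∧
      ρ = ∑ i, (p i : ℂ) • (ketbra (v i) ⊗ₖ ketbra (w i))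

/-- The partial transpose `(id_m ⊗ T)(ρ)`, where `T` is the transpose map on `M_n`. -/
def partialTranspose {m n : ℕ} (ρ : BipartiteMatrix m n) : BipartiteMatrix m n :=
  Matrix.of fun a b => ρ (a.1, b.2) (b.1, a.2)

/-- On elementary tensors the partial transpose is `A ⊗ B ↦ A ⊗ Bᵀ`. -/
theorem partialTranspose_kronecker {m n : ℕ} (A : Matrix (Fin m) (Fin m) ℂ)
    (B : Matrix (Fin n) (Fin n) ℂ) : partialTranspose (A ⊗ₖ B) = A ⊗ₖ Bᵀ := rfl

/-- Positive partial transpose. -/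
def IsPPT {m n : ℕ} (ρ : BipartiteMatrix m n) : Prop := (partialTranspose ρ).PosSemidef

/-- `U† ρ U` is separable for every unitary `U ∈ M_m ⊗ M_n`. -/
def IsSeparableFromSpectrum {m n : ℕ} (ρ : BipartiteMatrix m n) : Prop :=
  ∀ U ∈ Matrix.unitaryGroup (Fin m × Fin n) ℂ, IsSeparableState (Uᴴ * ρ * U)

/-- `U† ρ U` has positive partial transpose for every unitary `U ∈ M_m ⊗ M_n`. -/
def IsPPTFromSpectrum {m n : ℕ} (ρ : BipartiteMatrix m n) : Prop :=
  ∀ U ∈ Matrix.unitaryGroup (Fin m × Fin n) ℂ, IsPPT (Uᴴ * ρ * U)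

/-- The eigenvalues of a Hermitian matrix in `M_m ⊗ M_n`, repeated according to multiplicity and
listed in decreasing order; the index is zero-based, so the `k`-th largest has index `k - 1`. -/
noncomputable def sortedEigenvalue {m n : ℕ} {ρ : BipartiteMatrix m n} (hρ : ρ.IsHermitian)
    (i : Fin (m * n)) : ℝ :=
  hρ.eigenvalues₀ (Fin.cast (by simp) i)

theorem sortedEigenvalue_antitone {m n : ℕ} {ρ : BipartiteMatrix m n} (hρ : ρ.IsHermitian) :
    Antitone (sortedEigenvalue hρ) :=
  fun _ _ h => hρ.eigenvalues₀_antitone h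

/-! Write a matrix in `M_2 ⊗ M_n` as blocks `[[A, B], [B†, C]]`. The surprising implication is that
PPT from spectrum forces separability. It rests on a sufficient condition: if `‖B‖²` is at most the
product of the smallest eigenvalues of `A` and `C`, and these are nonnegative, the matrix is
separable (`blockMatrix_mem_separableCone`), because a contraction is an average of two unitaries
and a unitary is diagonalisable.

To reach this condition, apply PPT to the conjugates by `1 ⊕ V`. If unit vectors satisfy `|⟨x, v⟩| =
|⟨y, w⟩|`, some unitary `V` sends `v` to `y` and `x` to `w` up to a phase, and PPT yields `|⟨v, B
w⟩|² ≤ ⟨x, A x⟩ ⟨y, C y⟩`. This is the condition above once `x`, `y` are lowest eigenvectors of `A`,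
`C` and `v`, `w` is a top singular pair of `B`. Such a choice may be unbalanced, but rotating the
qubit by `π/2` exchanges `A` with `C` and turns `B` into `-B†`, which reverses the imbalance; by
connectedness some intermediate rotation is balanced (`exists_isExtremal_balanced_of_continuous`).
Qubit rotations are local, so they can be undone inside the separable cone.

For the eigenvalue criterion, the Schmidt decomposition reduces PPT to test vectors with orthogonal
halves. The form then involves one orthonormal quadruple, and Ky Fan's principle together with `λ_1`
bounds it below by a perfect square (`weighted_form_nonneg_of_le`). Conversely, one explicit unitary
makes a 2 × 2 minor of the partial transpose equivalent to the criterion. -/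

/-! ### The separable cone -/

/-- The convex cone generated by the (unnormalised) pure product states. -/
def separableCone (m n : ℕ) : AddSubmonoid (BipartiteMatrix m n) :=
  AddSubmonoid.closure {X | ∃ v w, X = ketbra v ⊗ₖ ketbra w}

theorem ketbra_kronecker_ketbra_mem {m n : ℕ} (v : Fin m → ℂ) (w : Fin n → ℂ) :
    ketbra v ⊗ₖ ketbra w ∈ separableCone m n :=
  AddSubmonoid.subset_closure ⟨v, w, rfl⟩

theorem ketbra_kronecker_mem {m n : ℕ} (v : Fin m → ℂ) {Q : Matrix (Fin n) (Fin n) ℂ}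
    (hQ : Q.PosSemidef) : ketbra v ⊗ₖ Q ∈ separableCone m n := by
  obtain ⟨k, w, rfl⟩ := Matrix.posSemidef_iff_eq_sum_vecMulVec.1 hQ
  have : ketbra v ⊗ₖ (∑ i, Matrix.vecMulVec (w i) (star (w i))) =
      ∑ i, ketbra v ⊗ₖ ketbra (w i) := by
    ext p q
    simp [Matrix.sum_apply, Finset.mul_sum, ketbra]
  rw [this]
  exact sum_mem fun i _ => ketbra_kronecker_ketbra_mem v (w i)

theorem ketbra_smul {d : ℕ} (c : ℂ) (v : Fin d → ℂ) :
    ketbra (c • v) = (c * star c) • ketbra v := by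
  ext i j
  simp [ketbra, Matrix.vecMulVec_apply]
  ring

theorem smul_mem_separableCone {m n : ℕ} {X : BipartiteMatrix m n} (hX : X ∈ separableCone m n)
    {r : ℝ} (hr : 0 ≤ r) : (r : ℂ) • X ∈ separableCone m n := by
  induction hX using AddSubmonoid.closure_induction with
  | mem x hx =>
    obtain ⟨v, w, rfl⟩ := hx
    have : (r : ℂ) • (ketbra v ⊗ₖ ketbra w) = ketbra ((√r : ℂ) • v) ⊗ₖ ketbra w := by
      rw [ketbra_smul, Matrix.smul_kronecker]
      congr 1
      simp [← Complex.ofReal_mul, Real.mul_self_sqrt hr]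
    rw [this]
    exact ketbra_kronecker_ketbra_mem _ _
  | zero => simp
  | add x y _ _ hx hy => rw [smul_add]; exact add_mem hx hy

theorem ketbra_mulVec {m : ℕ} (S : Matrix (Fin m) (Fin m) ℂ) (v : Fin m → ℂ) :
    ketbra (S *ᵥ v) = S * ketbra v * Sᴴ := by
  rw [ketbra, ketbra, Matrix.mul_vecMulVec, Matrix.vecMulVec_mul, Matrix.star_mulVec]

/-- Operations on the first factor send product vectors to product vectors; this will undo the qubit
rotation. -/
theorem conj_kronecker_mem_separableCone {m n : ℕ} {X : BipartiteMatrix m n}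
    (hX : X ∈ separableCone m n) (S : Matrix (Fin m) (Fin m) ℂ) :
    (S ⊗ₖ (1 : Matrix (Fin n) (Fin n) ℂ)) * X * (S ⊗ₖ (1 : Matrix (Fin n) (Fin n) ℂ))ᴴ ∈
      separableCone m n := by
  induction hX using AddSubmonoid.closure_induction with
  | mem x hx =>
    obtain ⟨v, w, rfl⟩ := hx
    rw [Matrix.conjTranspose_kronecker, ← Matrix.mul_kronecker_mul, ← Matrix.mul_kronecker_mul,
      ← ketbra_mulVec]
    simpa using ketbra_kronecker_ketbra_mem (S *ᵥ v) w
  | zero => simp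
  | add x y _ _ hx hy => rw [mul_add, add_mul]; exact add_mem hx hy

theorem exists_isPure_smul_eq {d : ℕ} {v : Fin d → ℂ} (hv : v ≠ 0) :
    ∃ (r : ℝ) (u : Fin d → ℂ), 0 ≤ r ∧ IsPure u ∧ ketbra v = (r : ℂ) • ketbra u := by
  have hpos : 0 < ‖WithLp.toLp 2 v‖ := by simpa using hv
  set r := ‖WithLp.toLp 2 v‖ with hr
  have hvv : star v ⬝ᵥ v = ((r ^ 2 : ℝ) : ℂ) := by
    have := inner_self_eq_norm_sq_to_K (𝕜 := ℂ) (WithLp.toLp 2 v)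
    rw [EuclideanSpace.inner_eq_star_dotProduct, dotProduct_comm] at this
    rw [hr, Complex.ofReal_pow]
    exact this
  have hrc : (r : ℂ) ≠ 0 := by exact_mod_cast hpos.ne'
  refine ⟨r ^ 2, (r : ℂ)⁻¹ • v, by positivity, ?_, ?_⟩
  · rw [IsPure, star_smul, smul_dotProduct, dotProduct_smul, hvv]
    simp
    field_simp
  · rw [ketbra_smul, smul_smul]
    have : ((r ^ 2 : ℝ) : ℂ) * ((r : ℂ)⁻¹ * star (r : ℂ)⁻¹) = 1 := by
      simp
      field_simp
    rw [this, one_smul]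

theorem exists_sum_of_mem_separableCone {m n : ℕ} {X : BipartiteMatrix m n}
    (hX : X ∈ separableCone m n) :
    ∃ (k : ℕ) (p : Fin k → ℝ) (v : Fin k → Fin m → ℂ) (w : Fin k → Fin n → ℂ),
      (∀ i, 0 ≤ p i) ∧ (∀ i, IsPure (v i)) ∧ (∀ i, IsPure (w i)) ∧
        X = ∑ i, (p i : ℂ) • (ketbra (v i) ⊗ₖ ketbra (w i)) := by
  induction hX using AddSubmonoid.closure_induction with
  | mem x hx =>
    obtain ⟨v, w, rfl⟩ := hx
    by_cases hv : v = 0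
    · exact ⟨0, Fin.elim0, Fin.elim0, Fin.elim0, fun i => i.elim0, fun i => i.elim0,
        fun i => i.elim0, by simp [hv, ketbra]⟩
    by_cases hw : w = 0
    · exact ⟨0, Fin.elim0, Fin.elim0, Fin.elim0, fun i => i.elim0, fun i => i.elim0,
        fun i => i.elim0, by simp [hw, ketbra]⟩
    obtain ⟨r, u, hr, hu, hvu⟩ := exists_isPure_smul_eq hv
    obtain ⟨s, z, hs, hz, hwz⟩ := exists_isPure_smul_eq hw
    refine ⟨1, fun _ => r * s, fun _ => u, fun _ => z, fun _ => mul_nonneg hr hs, fun _ => hu,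
      fun _ => hz, ?_⟩
    rw [hvu, hwz, Matrix.smul_kronecker, Matrix.kronecker_smul, smul_smul]
    simp only [Finset.univ_unique, Finset.sum_const, Finset.card_singleton, one_smul,
      Complex.ofReal_mul]
  | zero =>
    exact ⟨0, Fin.elim0, Fin.elim0, Fin.elim0, fun i => i.elim0, fun i => i.elim0,
      fun i => i.elim0, by simp⟩
  | add x y _ _ hx hy =>
    obtain ⟨k, p, v, w, hp, hv, hw, rfl⟩ := hx
    obtain ⟨l, q, a, b, hq, ha, hb, rfl⟩ := hy
    refine ⟨k + l, Fin.append p q, Fin.append v a, Fin.append w b, ?_, ?_, ?_, ?_⟩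
    · intro i; refine Fin.addCases ?_ ?_ i <;> simp [hp, hq]
    · intro i; refine Fin.addCases ?_ ?_ i <;> simp [hv, ha]
    · intro i; refine Fin.addCases ?_ ?_ i <;> simp [hw, hb]
    · simp [Fin.sum_univ_add]

theorem trace_ketbra {d : ℕ} {v : Fin d → ℂ} (hv : IsPure v) : (ketbra v).trace = 1 := by
  rw [ketbra, Matrix.trace_vecMulVec, dotProduct_comm]
  exact hv

theorem isSeparableState_of_mem_separableCone {m n : ℕ} {X : BipartiteMatrix m n}
    (hX : X ∈ separableCone m n) (htr : X.trace = 1) : IsSeparableState X := by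
  obtain ⟨k, p, v, w, hp, hv, hw, rfl⟩ := exists_sum_of_mem_separableCone hX
  refine ⟨k, p, v, w, hp, hv, hw, ?_, rfl⟩
  rw [Matrix.trace_sum] at htr
  simp only [Matrix.trace_smul, Matrix.trace_kronecker, trace_ketbra (hv _), trace_ketbra (hw _)]
    at htr
  simp only [mul_one, smul_eq_mul] at htr
  exact_mod_cast htr

/-- The matrix in `M_2 ⊗ M_n` with the given four blocks. -/
def blockMatrix {n : ℕ} (A B C D : Matrix (Fin n) (Fin n) ℂ) : BipartiteMatrix 2 n :=
  Matrix.of fun p q => (!![A, B; C, D] p.1 q.1) p.2 q.2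

/-! ### Diagonalisation of unitary matrices -/

section Diagonalisation

variable {n : ℕ} {ι : Type*} [Fintype ι]

theorem sum_vecMulVec_orthonormalBasis (b : OrthonormalBasis ι ℂ (EuclideanSpace ℂ (Fin n))) :
    ∑ k, Matrix.vecMulVec (b k).ofLp (star (b k).ofLp) = 1 := by
  ext i j
  have h := b.sum_inner_mul_inner (EuclideanSpace.single i 1) (EuclideanSpace.single j 1)
  simp [EuclideanSpace.inner_single_left, EuclideanSpace.inner_single_right] at h
  rw [Matrix.sum_apply]
  simpa [Matrix.vecMulVec_apply, Matrix.one_apply, Pi.single_apply, eq_comm (a := j)] using h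

theorem eq_sum_vecMulVec_mulVec (M : Matrix (Fin n) (Fin n) ℂ)
    (b : OrthonormalBasis ι ℂ (EuclideanSpace ℂ (Fin n))) :
    M = ∑ k, Matrix.vecMulVec (M *ᵥ (b k).ofLp) (star (b k).ofLp) := by
  conv_lhs => rw [← mul_one M, ← sum_vecMulVec_orthonormalBasis b, Finset.mul_sum]
  simp [Matrix.mul_vecMulVec]

/-- The Hermitian matrices `U + U†` and `i(U† - U)` commute, so they have a common orthonormal
eigenbasis, and `U` is a linear combination of them. -/
theorem exists_orthonormalBasis_eigenvectors_of_mem_unitary {U : Matrix (Fin n) (Fin n) ℂ}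
    (hU : U ∈ Matrix.unitaryGroup (Fin n) ℂ) :
    ∃ (b : OrthonormalBasis (Fin n) ℂ (EuclideanSpace ℂ (Fin n))) (d : Fin n → ℂ),
      (∀ k, d k * star (d k) = 1) ∧ ∀ k, U *ᵥ (b k).ofLp = d k • (b k).ofLp := by
  classical
  let H : Matrix (Fin n) (Fin n) ℂ := U + Uᴴ
  let G : Matrix (Fin n) (Fin n) ℂ := Complex.I • (Uᴴ - U)
  have h1 : U * Uᴴ = 1 := Matrix.mem_unitaryGroup_iff.1 hU
  have h2 : Uᴴ * U = 1 := Matrix.mem_unitaryGroup_iff'.1 hU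
  have hH : H.IsHermitian := by
    simp [H, Matrix.IsHermitian, add_comm]
  have hG : G.IsHermitian := by
    simp [G, Matrix.IsHermitian, ← smul_neg]
  have hHG : H * G = G * H := by
    simp only [H, G, mul_add, add_mul, mul_sub, sub_mul, h1, h2, Matrix.mul_smul, Matrix.smul_mul,
      ← smul_add]
  have hc : Commute H.toEuclideanLin G.toEuclideanLin := by
    refine LinearMap.ext fun x => ?_
    simp only [Module.End.mul_apply]
    simp only [Matrix.toLpLin_apply, Matrix.mulVec_mulVec, hHG]
  have hHs := Matrix.isSymmetric_toEuclideanLin_iff.2 hH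
  have hGs := Matrix.isSymmetric_toEuclideanLin_iff.2 hG
  have hI := DirectSum.isInternal_ne_bot_iff.2 (hHs.directSum_isInternal_of_commute hGs hc)
  have : Fintype {i : ℂ × ℂ // Module.End.eigenspace H.toEuclideanLin i.2 ⊓
      Module.End.eigenspace G.toEuclideanLin i.1 ≠ ⊥} :=
    (WellFoundedGT.finite_ne_bot_of_iSupIndep
      (hHs.directSum_isInternal_of_commute hGs hc).submodule_iSupIndep).fintype
  have hO := (hHs.orthogonalFamily_eigenspace_inf_eigenspace hGs).comp
    (Subtype.val_injective (p := fun i => Module.End.eigenspace H.toEuclideanLin i.2 ⊓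
      Module.End.eigenspace G.toEuclideanLin i.1 ≠ ⊥))
  let b := hI.subordinateOrthonormalBasis (n := n) (by simp) hO
  have hb : ∀ k, ∃ d : ℂ, U *ᵥ (b k).ofLp = d • (b k).ofLp := by
    intro k
    obtain ⟨e1, e2⟩ := hI.subordinateOrthonormalBasis_subordinate (n := n) (by simp) k hO
    have e1 := congrArg WithLp.ofLp (Module.End.mem_eigenspace_iff.1 e1)
    have e2 := congrArg WithLp.ofLp (Module.End.mem_eigenspace_iff.1 e2)
    simp only [Matrix.ofLp_toLpLin, Matrix.toLin'_apply, WithLp.ofLp_smul] at e1 e2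
    obtain ⟨x, e1⟩ : ∃ x : ℂ, H *ᵥ (b k).ofLp = x • (b k).ofLp := ⟨_, e1⟩
    obtain ⟨y, e2⟩ : ∃ y : ℂ, G *ᵥ (b k).ofLp = y • (b k).ofLp := ⟨_, e2⟩
    have hUe : U = (1 / 2 : ℂ) • (H + Complex.I • G) := by
      simp only [H, G, smul_smul, Complex.I_mul_I]
      ext i j
      simp
      ring
    refine ⟨(1 / 2) * (x + Complex.I * y), ?_⟩
    conv_lhs => rw [hUe, Matrix.smul_mulVec, Matrix.add_mulVec, Matrix.smul_mulVec, e1, e2]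
    rw [smul_smul, ← add_smul, smul_smul]
  choose d hd using hb
  refine ⟨b, d, fun k => ?_, hd⟩
  have hn : star (b k).ofLp ⬝ᵥ (b k).ofLp = 1 := by
    have := b.inner_eq_one k
    rwa [EuclideanSpace.inner_eq_star_dotProduct, dotProduct_comm] at this
  have : star (U *ᵥ (b k).ofLp) ⬝ᵥ (U *ᵥ (b k).ofLp) = 1 := by
    rw [Matrix.star_mulVec, Matrix.dotProduct_mulVec, Matrix.vecMul_vecMul, h2, Matrix.vecMul_one,
      hn]
  rw [hd, star_smul, smul_dotProduct, dotProduct_smul, hn] at this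
  simpa [mul_comm] using this

end Diagonalisation

theorem ketbra_apply {d : ℕ} (v : Fin d → ℂ) (i j : Fin d) : ketbra v i j = v i * star (v j) :=
  rfl

/-! ### Separability when the off-diagonal block is small -/

section Contraction

variable {n : ℕ}

theorem star_dotProduct_orthonormalBasis {ι : Type*} [Fintype ι] [DecidableEq ι]
    (b : OrthonormalBasis ι ℂ (EuclideanSpace ℂ (Fin n))) (k l : ι) :
    star (b k).ofLp ⬝ᵥ (b l).ofLp = if k = l then 1 else 0 := by
  have := orthonormal_iff_ite.1 b.orthonormal k l
  rwa [EuclideanSpace.inner_eq_star_dotProduct, dotProduct_comm] at this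

theorem sum_smul_vecMulVec_mem_unitaryGroup
    (b b' : OrthonormalBasis (Fin n) ℂ (EuclideanSpace ℂ (Fin n))) (c : Fin n → ℂ)
    (hc : ∀ k, c k * star (c k) = 1) :
    ∑ k, c k • Matrix.vecMulVec (b' k).ofLp (star (b k).ofLp) ∈
      Matrix.unitaryGroup (Fin n) ℂ := by
  rw [Matrix.mem_unitaryGroup_iff, Matrix.star_eq_conjTranspose, Matrix.conjTranspose_sum,
    Finset.sum_mul_sum, ← sum_vecMulVec_orthonormalBasis b']
  refine Finset.sum_congr rfl fun k _ => ?_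
  rw [Finset.sum_eq_single k]
  · rw [Matrix.conjTranspose_smul, Matrix.conjTranspose_vecMulVec, star_star, Matrix.smul_mul,
      Matrix.mul_smul, Matrix.vecMulVec_mul_vecMulVec, star_dotProduct_orthonormalBasis, if_pos rfl,
      smul_smul, hc]
    simp
  · intro l _ hl
    rw [Matrix.conjTranspose_smul, Matrix.conjTranspose_vecMulVec, star_star, Matrix.smul_mul,
      Matrix.mul_smul, Matrix.vecMulVec_mul_vecMulVec, star_dotProduct_orthonormalBasis,
      if_neg hl.symm]
    simp
  · simp

/-- Singular value decomposition: an eigenbasis of `K†K` has pairwise orthogonal images under `K`,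
and the normalised nonzero images extend to a second orthonormal basis. -/
theorem exists_singular_bases (K : Matrix (Fin n) (Fin n) ℂ) :
    ∃ (b b' : OrthonormalBasis (Fin n) ℂ (EuclideanSpace ℂ (Fin n))),
      ∀ k, WithLp.toLp 2 (K *ᵥ (b k).ofLp) = (‖WithLp.toLp 2 (K *ᵥ (b k).ofLp)‖ : ℂ) • b' k := by
  have hH : (Kᴴ * K).IsHermitian := Matrix.isHermitian_conjTranspose_mul_self K
  let b := hH.eigenvectorBasis
  have horth : ∀ k l, k ≠ l →
      inner ℂ (WithLp.toLp 2 (K *ᵥ (b k).ofLp)) (WithLp.toLp 2 (K *ᵥ (b l).ofLp)) = 0 := by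
    intro k l hkl
    rw [EuclideanSpace.inner_eq_star_dotProduct, dotProduct_comm]
    have : star (K *ᵥ (b k).ofLp) ⬝ᵥ (K *ᵥ (b l).ofLp) =
        star (b k).ofLp ⬝ᵥ ((Kᴴ * K) *ᵥ (b l).ofLp) := by
      rw [Matrix.star_mulVec, Matrix.dotProduct_mulVec, Matrix.dotProduct_mulVec,
        Matrix.vecMul_vecMul]
    change star (K *ᵥ (b k).ofLp) ⬝ᵥ (K *ᵥ (b l).ofLp) = 0
    rw [this, hH.mulVec_eigenvectorBasis, dotProduct_smul, star_dotProduct_orthonormalBasis,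
      if_neg hkl, smul_zero]
  let s : Set (Fin n) := {k | WithLp.toLp 2 (K *ᵥ (b k).ofLp) ≠ 0}
  let v : Fin n → EuclideanSpace ℂ (Fin n) := fun k =>
    ((‖WithLp.toLp 2 (K *ᵥ (b k).ofLp)‖ : ℂ)⁻¹) • WithLp.toLp 2 (K *ᵥ (b k).ofLp)
  have hv : Orthonormal ℂ (s.domRestrict v) := by
    constructor
    · rintro ⟨k, hk⟩
      exact norm_smul_inv_norm hk
    · rintro ⟨k, hk⟩ ⟨l, hl⟩ hkl
      have : k ≠ l := fun h => hkl (by simp [h])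
      simp only [Set.domRestrict, v, inner_smul_left, inner_smul_right, horth k l this, mul_zero]
  obtain ⟨b', hb'⟩ := hv.exists_orthonormalBasis_extension_of_card_eq (by simp)
  refine ⟨b, b', fun k => ?_⟩
  by_cases hk : WithLp.toLp 2 (K *ᵥ (b k).ofLp) = 0
  · rw [hk]; simp
  · rw [hb' k hk, smul_smul, mul_inv_cancel₀, one_smul]
    exact_mod_cast norm_ne_zero_iff.2 hk

/-- Each singular value `σ ≤ 1` is the mean of the two unimodular numbers `σ ± i√(1 - σ²)`. -/
theorem exists_unitary_average_of_contraction (K : Matrix (Fin n) (Fin n) ℂ)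
    (hK : ∀ x : EuclideanSpace ℂ (Fin n), ‖x‖ = 1 → ‖WithLp.toLp 2 (K *ᵥ x.ofLp)‖ ≤ 1) :
    ∃ U ∈ Matrix.unitaryGroup (Fin n) ℂ, ∃ V ∈ Matrix.unitaryGroup (Fin n) ℂ,
      K = (1 / 2 : ℂ) • (U + V) := by
  obtain ⟨b, b', hb⟩ := exists_singular_bases K
  set σ : Fin n → ℝ := fun k => ‖WithLp.toLp 2 (K *ᵥ (b k).ofLp)‖ with hσ
  have h0 : ∀ k, 0 ≤ σ k := fun k => norm_nonneg _
  have h1 : ∀ k, σ k ≤ 1 := fun k => hK _ (b.norm_eq_one k)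
  have hs : ∀ k, ((√(1 - σ k ^ 2) : ℝ) : ℂ) * (√(1 - σ k ^ 2) : ℝ) = 1 - (σ k : ℂ) * σ k := by
    intro k
    rw [← Complex.ofReal_mul, Real.mul_self_sqrt (by nlinarith [h0 k, h1 k])]
    push_cast; ring
  refine ⟨_, sum_smul_vecMulVec_mem_unitaryGroup b b'
    (fun k => σ k + Complex.I * √(1 - σ k ^ 2)) ?_, _, sum_smul_vecMulVec_mem_unitaryGroup b b'
    (fun k => σ k - Complex.I * √(1 - σ k ^ 2)) ?_, ?_⟩
  · intro k
    simp
    linear_combination hs k - ((√(1 - σ k ^ 2) : ℝ) : ℂ) * (√(1 - σ k ^ 2) : ℝ) * Complex.I_mul_I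
  · intro k
    simp
    linear_combination hs k - ((√(1 - σ k ^ 2) : ℝ) : ℂ) * (√(1 - σ k ^ 2) : ℝ) * Complex.I_mul_I
  · rw [← Finset.sum_add_distrib, Finset.smul_sum]
    conv_lhs => rw [eq_sum_vecMulVec_mulVec K b]
    refine Finset.sum_congr rfl fun k _ => ?_
    have hk : K *ᵥ (b k).ofLp = (σ k : ℂ) • (b' k).ofLp := congrArg WithLp.ofLp (hb k)
    rw [hk, Matrix.smul_vecMulVec, ← add_smul, smul_smul]
    congr 1
    ring

/-- With `U = ∑ d_k |b_k⟩⟨b_k|`, the matrix is the sum of the product projectors on `(s, t d̄_k) ⊗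
b_k`; `|d_k| = 1` makes the lower diagonal block scalar. -/
theorem blockMatrix_unitary_mem_separableCone {U : Matrix (Fin n) (Fin n) ℂ}
    (hU : U ∈ Matrix.unitaryGroup (Fin n) ℂ) (s t : ℝ) :
    blockMatrix (((s * s : ℝ) : ℂ) • (1 : Matrix (Fin n) (Fin n) ℂ)) (((s * t : ℝ) : ℂ) • U)
      (((s * t : ℝ) : ℂ) • Uᴴ) (((t * t : ℝ) : ℂ) • 1) ∈ separableCone 2 n := by
  obtain ⟨b, d, hd, hb⟩ := exists_orthonormalBasis_eigenvectors_of_mem_unitary hU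
  have hU' : U = ∑ k, d k • ketbra (b k).ofLp := by
    rw [eq_sum_vecMulVec_mulVec U b]
    simp_rw [hb, Matrix.smul_vecMulVec, ketbra]
  have h1 : (1 : Matrix (Fin n) (Fin n) ℂ) = ∑ k, ketbra (b k).ofLp :=
    (sum_vecMulVec_orthonormalBasis b).symm
  have hUs : Uᴴ = ∑ k, star (d k) • ketbra (b k).ofLp := by
    rw [hU', Matrix.conjTranspose_sum]
    simp [ketbra, Matrix.conjTranspose_smul, Matrix.conjTranspose_vecMulVec]
  have : blockMatrix (((s * s : ℝ) : ℂ) • (1 : Matrix (Fin n) (Fin n) ℂ)) (((s * t : ℝ) : ℂ) • U)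
      (((s * t : ℝ) : ℂ) • Uᴴ) (((t * t : ℝ) : ℂ) • 1) =
      ∑ k, ketbra ![(s : ℂ), t * star (d k)] ⊗ₖ ketbra (b k).ofLp := by
    rw [hUs, hU', h1]
    ext ⟨a, i⟩ ⟨a', j⟩
    have hd' : ∀ k, (starRingEnd ℂ) (d k) * d k = 1 := fun k => by rw [mul_comm]; exact hd k
    fin_cases a <;> fin_cases a' <;>
      simp [blockMatrix, Matrix.sum_apply, ketbra_apply, Finset.mul_sum] <;>
      refine Finset.sum_congr rfl fun k _ => ?_
    · ring
    · ring
    · linear_combination -((t : ℂ) * t * ((b k).ofLp i * (starRingEnd ℂ) ((b k).ofLp j))) * hd' k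
  rw [this]
  exact sum_mem fun k _ => ketbra_kronecker_ketbra_mem _ _

theorem norm_mulVec_le_of_inner_le {B : Matrix (Fin n) (Fin n) ℂ} {r : ℝ} (hr : 0 ≤ r)
    (hB : ∀ v w : EuclideanSpace ℂ (Fin n), ‖v‖ = 1 → ‖w‖ = 1 →
      ‖inner ℂ v (WithLp.toLp 2 (B *ᵥ w.ofLp))‖ ≤ r) {w : EuclideanSpace ℂ (Fin n)}
    (hw : ‖w‖ = 1) : ‖WithLp.toLp 2 (B *ᵥ w.ofLp)‖ ≤ r := by
  set z := WithLp.toLp 2 (B *ᵥ w.ofLp)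
  by_cases hz : z = 0
  · simpa [hz] using hr
  have := hB ((‖z‖ : ℂ)⁻¹ • z) w (norm_smul_inv_norm hz) hw
  change ‖inner ℂ ((‖z‖ : ℂ)⁻¹ • z) z‖ ≤ r at this
  rw [inner_smul_left, norm_mul, inner_self_eq_norm_sq_to_K] at this
  have hz' : ‖z‖ ≠ 0 := norm_ne_zero_iff.2 hz
  have e : ‖(starRingEnd ℂ) (‖z‖ : ℂ)⁻¹‖ * ‖((‖z‖ : ℝ) : ℂ) ^ 2‖ = ‖z‖ := by
    simp
    field_simp
  exact e ▸ this

/-- The excesses `A - a` and `C - c` are positive and contribute separable terms. What remains has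
diagonal blocks `a`, `c` and off-diagonal block `√(ac) K` with `K` a contraction, hence is an
average of two matrices of the unitary type. -/
theorem blockMatrix_mem_separableCone {A B C : Matrix (Fin n) (Fin n) ℂ} {a c : ℝ} (ha : 0 ≤ a)
    (hc : 0 ≤ c) (hA : (A - (a : ℂ) • 1).PosSemidef) (hC : (C - (c : ℂ) • 1).PosSemidef)
    (hB : ∀ v w : EuclideanSpace ℂ (Fin n), ‖v‖ = 1 → ‖w‖ = 1 →
      ‖inner ℂ v (WithLp.toLp 2 (B *ᵥ w.ofLp))‖ ^ 2 ≤ a * c) :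
    blockMatrix A B Bᴴ C ∈ separableCone 2 n := by
  have hB' : ∀ w : EuclideanSpace ℂ (Fin n), ‖w‖ = 1 →
      ‖WithLp.toLp 2 (B *ᵥ w.ofLp)‖ ≤ √a * √c := by
    refine fun w => norm_mulVec_le_of_inner_le (by positivity) fun v w hv hw => ?_
    rw [← Real.sqrt_mul ha]
    exact Real.le_sqrt_of_sq_le (hB v w hv hw)
  obtain ⟨K, hK, hBK⟩ : ∃ K : Matrix (Fin n) (Fin n) ℂ,
      (∀ x : EuclideanSpace ℂ (Fin n), ‖x‖ = 1 → ‖WithLp.toLp 2 (K *ᵥ x.ofLp)‖ ≤ 1) ∧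
      B = ((√a * √c : ℝ) : ℂ) • K := by
    rcases (mul_nonneg (Real.sqrt_nonneg a) (Real.sqrt_nonneg c)).eq_or_lt with h | h
    -- No division is possible when `ac = 0`, but then the bound forces `B = 0`.
    · refine ⟨0, by simp, ?_⟩
      rw [← h]
      obtain ⟨b, -⟩ := exists_singular_bases B
      rw [eq_sum_vecMulVec_mulVec B b]
      simp only [Complex.ofReal_zero, zero_smul]
      refine Finset.sum_eq_zero fun k _ => ?_
      have := hB' _ (b.norm_eq_one k)
      rw [← h] at this
      have : B *ᵥ (b k).ofLp = 0 := by simpa using this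
      rw [this, Matrix.zero_vecMulVec]
    · have hne : ((√a * √c : ℝ) : ℂ) ≠ 0 := by exact_mod_cast h.ne'
      refine ⟨((√a * √c : ℝ) : ℂ)⁻¹ • B, fun x hx => ?_, ?_⟩
      · rw [Matrix.smul_mulVec, WithLp.toLp_smul, norm_smul, norm_inv, Complex.norm_real,
          Real.norm_of_nonneg h.le, inv_mul_le_one₀ h]
        exact hB' x hx
      · rw [smul_smul, mul_inv_cancel₀ hne, one_smul]
  obtain ⟨U, hU, V, hV, hKUV⟩ := exists_unitary_average_of_contraction K hK
  have hBs : Bᴴ = ((√a * √c : ℝ) : ℂ) • (1 / 2 : ℂ) • (Uᴴ + Vᴴ) := by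
    rw [hBK, hKUV, Matrix.conjTranspose_smul, Matrix.conjTranspose_smul, Matrix.conjTranspose_add]
    simp
  have hsum : blockMatrix A B Bᴴ C =
      (ketbra ![1, 0] ⊗ₖ (A - (a : ℂ) • 1) + ketbra ![0, 1] ⊗ₖ (C - (c : ℂ) • 1)) +
      (((1 / 2 : ℝ) : ℂ) • blockMatrix (((√a * √a : ℝ) : ℂ) • (1 : Matrix (Fin n) (Fin n) ℂ))
          (((√a * √c : ℝ) : ℂ) • U) (((√a * √c : ℝ) : ℂ) • Uᴴ) (((√c * √c : ℝ) : ℂ) • 1) +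
        ((1 / 2 : ℝ) : ℂ) • blockMatrix (((√a * √a : ℝ) : ℂ) • (1 : Matrix (Fin n) (Fin n) ℂ))
          (((√a * √c : ℝ) : ℂ) • V) (((√a * √c : ℝ) : ℂ) • Vᴴ) (((√c * √c : ℝ) : ℂ) • 1)) := by
    rw [hBs, hBK, hKUV, Real.mul_self_sqrt ha, Real.mul_self_sqrt hc]
    ext ⟨p, i⟩ ⟨q, j⟩
    fin_cases p <;> fin_cases q <;>
      simp [blockMatrix, ketbra_apply] <;> ring
  rw [hsum]
  exact add_mem (add_mem (ketbra_kronecker_mem _ hA) (ketbra_kronecker_mem _ hC))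
    (add_mem (smul_mem_separableCone (blockMatrix_unitary_mem_separableCone hU _ _) (by norm_num))
      (smul_mem_separableCone (blockMatrix_unitary_mem_separableCone hV _ _) (by norm_num)))

end Contraction

/-! ### Balancing extremal vectors by connectedness -/

section Extremal

variable {E : Type*} [NormedAddCommGroup E] [InnerProductSpace ℂ E]

/-- `x` is a unit vector minimising the quadratic form of `T` on the unit sphere. -/
def IsMinUnit (T : E →L[ℂ] E) (x : E) : Prop :=
  ‖x‖ = 1 ∧ ∀ y, ‖y‖ = 1 → (inner ℂ x (T x)).re ≤ (inner ℂ y (T y)).re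

/-- `v`, `w` are unit vectors maximising the modulus of the sesquilinear form of `B`. -/
def IsMaxPair (B : E →L[ℂ] E) (v w : E) : Prop :=
  ‖v‖ = 1 ∧ ‖w‖ = 1 ∧ ∀ v' w', ‖v'‖ = 1 → ‖w'‖ = 1 → ‖inner ℂ v' (B w')‖ ≤ ‖inner ℂ v (B w)‖

/-- A nonzero complex subspace has real dimension at least two, so its unit sphere is connected. -/
theorem isPreconnected_unit_sphere_submodule (S : Submodule ℂ E) :
    IsPreconnected {x : E | x ∈ S ∧ ‖x‖ = 1} := by
  rcases subsingleton_or_nontrivial S with hS | hS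
  · have : {x : E | x ∈ S ∧ ‖x‖ = 1} = ∅ := by
      ext x
      simp only [Set.mem_ofPred_eq, Set.mem_empty_iff_false, iff_false]
      rintro ⟨hx, h1⟩
      have := congrArg Subtype.val (Subsingleton.elim (⟨x, hx⟩ : S) 0)
      simp only [ZeroMemClass.coe_zero] at this
      simp [this] at h1
    rw [this]; exact isPreconnected_empty
  · have hr : 1 < Module.rank ℝ S := by
      rw [rank_real_of_complex]
      have h1 : (1 : Cardinal) ≤ Module.rank ℂ S := Cardinal.one_le_iff_pos.2 rank_pos
      calc (1 : Cardinal) < 2 * 1 := by norm_num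
        _ ≤ 2 * Module.rank ℂ S := by gcongr
    have := (isPreconnected_sphere hr (0 : S) 1).image Subtype.val
      continuous_subtype_val.continuousOn
    convert this using 1
    ext x
    simp [and_comm]

/-- The unit vector along `B z` competes in the maximum, which therefore dominates `B` on the unit
sphere. -/
theorem IsMaxPair.norm_apply_le {B : E →L[ℂ] E} {v w : E} (h : IsMaxPair B v w) {z : E}
    (hz : ‖z‖ = 1) : ‖B z‖ ≤ ‖inner ℂ v (B w)‖ := by
  by_cases h0 : B z = 0
  · simp [h0]
  have := h.2.2 ((‖B z‖ : ℂ)⁻¹ • B z) z (norm_smul_inv_norm h0) hz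
  rw [inner_smul_left, norm_mul, inner_self_eq_norm_sq_to_K] at this
  have hz' : ‖B z‖ ≠ 0 := norm_ne_zero_iff.2 h0
  have e : ‖(starRingEnd ℂ) (‖B z‖ : ℂ)⁻¹‖ * ‖((‖B z‖ : ℝ) : ℂ) ^ 2‖ = ‖B z‖ := by
    simp
    field_simp
  exact e ▸ this

theorem IsMaxPair.norm_apply {B : E →L[ℂ] E} {v w : E} (h : IsMaxPair B v w) :
    ‖B w‖ = ‖inner ℂ v (B w)‖ := by
  refine le_antisymm (h.norm_apply_le h.2.1) ?_
  simpa [h.1] using norm_inner_le_norm (𝕜 := ℂ) v (B w)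

/-- The equality case of Cauchy–Schwarz. -/
theorem IsMaxPair.apply_eq {B : E →L[ℂ] E} {v w : E} (h : IsMaxPair B v w) :
    B w = inner ℂ v (B w) • v := by
  have h1 : ‖B w - inner ℂ v (B w) • v‖ ^ 2 = 0 := by
    rw [@norm_sub_sq ℂ, inner_smul_right, ← inner_conj_symm (B w) v, norm_smul, h.1, h.norm_apply,
      Complex.mul_conj, Complex.normSq_eq_norm_sq]
    simp only [RCLike.re_to_complex, Complex.ofReal_re, mul_one]
    ring
  exact sub_eq_zero.1 (norm_eq_zero.1 (pow_eq_zero_iff two_ne_zero |>.1 h1))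

variable [FiniteDimensional ℂ E]

theorem IsMinUnit.apply_eq {T : E →L[ℂ] E} (hT : IsSelfAdjoint T) {x : E} (hx : IsMinUnit T x) :
    T x = (((inner ℂ x (T x)).re : ℝ) : ℂ) • x := by
  have hre : ∀ y, T.reApplyInnerSelf y = (inner ℂ y (T y)).re := fun y => by
    rw [ContinuousLinearMap.reApplyInnerSelf_apply, inner_re_symm]; rfl
  have hmin : IsMinOn T.reApplyInnerSelf (Metric.sphere 0 ‖x‖) x := by
    intro y hy
    have hy : ‖y‖ = 1 := by simpa [hx.1] using hy
    simpa only [Set.mem_ofPred_eq, hre] using hx.2 y hy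
  have := IsSelfAdjoint.eq_smul_self_of_isLocalExtrOn hT (Or.inl hmin.localize)
  rw [ContinuousLinearMap.rayleighQuotient, hre, hx.1] at this
  simpa using this

/-- The minimisers form the unit sphere of the lowest eigenspace. -/
theorem isPreconnected_setOf_isMinUnit {T : E →L[ℂ] E} (hT : IsSelfAdjoint T) :
    IsPreconnected {x | IsMinUnit T x} := by
  rcases Set.eq_empty_or_nonempty {x | IsMinUnit T x} with h | ⟨x₀, h₀⟩
  · rw [h]; exact isPreconnected_empty
  convert isPreconnected_unit_sphere_submodule
    (Module.End.eigenspace (T : E →ₗ[ℂ] E) (((inner ℂ x₀ (T x₀)).re : ℝ) : ℂ)) using 1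
  ext x
  simp only [Set.mem_ofPred_eq, Module.End.mem_eigenspace_iff, ContinuousLinearMap.coe_coe]
  constructor
  · intro hx
    refine ⟨?_, hx.1⟩
    rw [hx.apply_eq hT, le_antisymm (hx.2 _ h₀.1) (h₀.2 _ hx.1)]
  · rintro ⟨hx, h1⟩
    refine ⟨h1, fun y hy => ?_⟩
    rw [hx, inner_smul_right, inner_self_eq_norm_sq_to_K, h1]
    simpa using h₀.2 y hy

theorem exists_isMinUnit [Nontrivial E] (T : E →L[ℂ] E) : ∃ x, IsMinUnit T x := by
  have : ProperSpace E := FiniteDimensional.proper ℂ E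
  obtain ⟨x, hx, hmin⟩ := (isCompact_sphere (0 : E) 1).exists_isMinOn
    (NormedSpace.sphere_nonempty.2 zero_le_one)
    (f := fun x => (inner ℂ x (T x)).re) (by fun_prop)
  exact ⟨x, by simpa using hx, fun y hy => hmin (by simpa using hy)⟩

theorem exists_isMaxPair [Nontrivial E] (B : E →L[ℂ] E) : ∃ v w, IsMaxPair B v w := by
  have : ProperSpace E := FiniteDimensional.proper ℂ E
  have hne : (Metric.sphere (0 : E) 1).Nonempty := NormedSpace.sphere_nonempty.2 zero_le_one
  obtain ⟨p, hp, hmax⟩ := ((isCompact_sphere (0 : E) 1).prod (isCompact_sphere (0 : E)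
    1)).exists_isMaxOn (hne.prod hne) (f := fun p : E × E => ‖inner ℂ p.1 (B p.2)‖) (by fun_prop)
  simp only [Set.mem_prod, mem_sphere_iff_norm, sub_zero] at hp
  exact ⟨p.1, p.2, hp.1, hp.2, fun v w hv hw => hmax (a := (v, w)) (by simp [hv, hw])⟩

theorem inner_neg_adjoint_comp (B : E →L[ℂ] E) (z : E) :
    (inner ℂ z ((-(ContinuousLinearMap.adjoint B ∘L B)) z)).re = -‖B z‖ ^ 2 := by
  rw [neg_apply, inner_neg_right, ContinuousLinearMap.comp_apply,
    ContinuousLinearMap.adjoint_inner_right, inner_self_eq_norm_sq_to_K]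
  norm_cast

/-- Top right singular vectors of `B` are lowest eigenvectors of `-B†B`, so the connectedness of
minimisers applies to them too. -/
theorem IsMaxPair.isMinUnit {B : E →L[ℂ] E} {v w : E} (h : IsMaxPair B v w) :
    IsMinUnit (-(ContinuousLinearMap.adjoint B ∘L B)) w := by
  refine ⟨h.2.1, fun y hy => ?_⟩
  rw [inner_neg_adjoint_comp, inner_neg_adjoint_comp, neg_le_neg_iff]
  gcongr
  rw [h.norm_apply]
  exact h.norm_apply_le hy

theorem IsMinUnit.isMaxPair {B : E →L[ℂ] E} {w : E}
    (h : IsMinUnit (-(ContinuousLinearMap.adjoint B ∘L B)) w) (h0 : B w ≠ 0) :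
    IsMaxPair B ((‖B w‖ : ℂ)⁻¹ • B w) w := by
  refine ⟨norm_smul_inv_norm h0, h.1, fun v' w' hv hw => ?_⟩
  have h1 : ‖B w'‖ ≤ ‖B w‖ := by
    have := h.2 w' hw
    rw [inner_neg_adjoint_comp, inner_neg_adjoint_comp, neg_le_neg_iff] at this
    exact le_of_sq_le_sq this (norm_nonneg _)
  have hz' : ‖B w‖ ≠ 0 := norm_ne_zero_iff.2 h0
  have e : ‖inner ℂ ((‖B w‖ : ℂ)⁻¹ • B w) (B w)‖ = ‖B w‖ := by
    rw [inner_smul_left, norm_mul, inner_self_eq_norm_sq_to_K]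
    simp
    field_simp
  rw [e]
  calc ‖inner ℂ v' (B w')‖ ≤ ‖v'‖ * ‖B w'‖ := norm_inner_le_norm _ _
    _ ≤ ‖B w‖ := by rwa [hv, one_mul]

/-- The minimising vectors of `A` and `C` and the maximising pair of `B`, together. -/
def IsExtremal (A C B : E →L[ℂ] E) (x y v w : E) : Prop :=
  IsMinUnit A x ∧ IsMinUnit C y ∧ IsMaxPair B v w

/-- At a fixed operator triple, two extremal choices with opposite imbalance are joined through the
connected product of the three sets of minimisers, and the intermediate value theorem applies. -/
theorem exists_isExtremal_balanced {A C B : E →L[ℂ] E} (hA : IsSelfAdjoint A)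
    (hC : IsSelfAdjoint C) {x y v w x' y' v' w' : E} (h : IsExtremal A C B x y v w)
    (h' : IsExtremal A C B x' y' v' w') (hle : ‖inner ℂ y w‖ ≤ ‖inner ℂ x v‖)
    (hle' : ‖inner ℂ x' v'‖ ≤ ‖inner ℂ y' w'‖) :
    ∃ x y v w, IsExtremal A C B x y v w ∧ ‖inner ℂ x v‖ = ‖inner ℂ y w‖ := by
  obtain ⟨hx, hy, hvw⟩ := h
  obtain ⟨hx', hy', hvw'⟩ := h'
  -- If `B = 0`, every pair of unit vectors is maximal, and `v = x`, `w = y` is balanced.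
  by_cases h0 : ‖inner ℂ v (B w)‖ = 0
  · have hB : ∀ z, ‖z‖ = 1 → B z = 0 := fun z hz => by
      simpa [h0] using hvw.norm_apply_le hz
    refine ⟨x, y, x, y, ⟨hx, hy, hx.1, hy.1, fun p q _ hq => ?_⟩, ?_⟩
    · simp [hB q hq]
    · simp [inner_self_eq_norm_sq_to_K, hx.1, hy.1]
  have hD : IsSelfAdjoint (-(ContinuousLinearMap.adjoint B ∘L B)) :=
    (IsSelfAdjoint.star_mul_self B).neg
  have hpre := (isPreconnected_setOf_isMinUnit hA).prod ((isPreconnected_setOf_isMinUnit hC).prod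
    (isPreconnected_setOf_isMinUnit hD))
  -- The imbalance multiplied by `‖B w‖`: since `B w` is parallel to `v`, this removes both the
  -- vector `v` and the division by `‖B w‖`.
  let f : E × E × E → ℝ := fun p => ‖inner ℂ p.1 (B p.2.2)‖ - ‖B p.2.2‖ * ‖inner ℂ p.2.1 p.2.2‖
  have hf : Continuous f := by fun_prop
  have hval : ∀ {x y v w : E}, IsMaxPair B v w →
      f (x, y, w) = ‖B w‖ * (‖inner ℂ x v‖ - ‖inner ℂ y w‖) := by
    intro x y v w h
    have : ‖inner ℂ x (B w)‖ = ‖B w‖ * ‖inner ℂ x v‖ := by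
      rw [h.apply_eq, inner_smul_right, norm_mul, norm_smul, h.1, mul_one]
    simp only [f, this]
    ring
  have hneg : f (x', y', w') ≤ 0 := by
    rw [hval hvw']
    exact mul_nonpos_of_nonneg_of_nonpos (norm_nonneg _) (sub_nonpos.2 hle')
  have hpos : 0 ≤ f (x, y, w) := by
    rw [hval hvw]
    exact mul_nonneg (norm_nonneg _) (sub_nonneg.2 hle)
  obtain ⟨⟨p, q, r⟩, ⟨hp, hq, hr⟩, hpqr⟩ := hpre.intermediate_value (a := (x', y', w'))
    (b := (x, y, w)) ⟨hx', hy', hvw'.isMinUnit⟩ ⟨hx, hy, hvw.isMinUnit⟩ hf.continuousOn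
    ⟨hneg, hpos⟩
  have hr : IsMinUnit (-(ContinuousLinearMap.adjoint B ∘L B)) r := hr
  have hBr : B r ≠ 0 := by
    intro h
    have := hr.2 w hvw.2.1
    rw [inner_neg_adjoint_comp, inner_neg_adjoint_comp, neg_le_neg_iff, h, hvw.norm_apply] at this
    have : ‖inner ℂ v (B w)‖ ^ 2 ≤ 0 := by simpa using this
    exact h0 (pow_eq_zero_iff two_ne_zero |>.1 (le_antisymm this (sq_nonneg _)))
  refine ⟨p, q, _, r, ⟨hp, hq, hr.isMaxPair hBr⟩, ?_⟩
  rw [hval (hr.isMaxPair hBr)] at hpqr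
  exact sub_eq_zero.1 ((mul_eq_zero.1 hpqr).resolve_left (norm_ne_zero_iff.2 hBr))

/-- The extremality conditions are closed in the parameter and the vectors jointly, the vectors
range over compact spheres, and projection along a compact factor is a closed map. -/
theorem isClosed_setOf_exists_isExtremal {A C B : ℝ → E →L[ℂ] E} (hA : Continuous A)
    (hC : Continuous C) (hB : Continuous B) :
    IsClosed {t | ∃ x y v w, IsExtremal (A t) (C t) (B t) x y v w ∧
      ‖inner ℂ y w‖ ≤ ‖inner ℂ x v‖} := by
  have : ProperSpace E := FiniteDimensional.proper ℂ E
  let S := Metric.sphere (0 : E) 1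
  have : CompactSpace S := isCompact_iff_compactSpace.1 (isCompact_sphere (0 : E) 1)
  have h1 : IsClosed {p : ℝ × (S × S) × S × S | ∀ z, ‖z‖ = 1 →
      (inner ℂ (p.2.1.1 : E) (A p.1 (p.2.1.1 : E))).re ≤ (inner ℂ z (A p.1 z)).re} := by
    simp only [Set.ofPred_forall]
    exact isClosed_iInter fun z => isClosed_iInter fun _ => isClosed_le (by fun_prop) (by fun_prop)
  have h2 : IsClosed {p : ℝ × (S × S) × S × S | ∀ z, ‖z‖ = 1 →
      (inner ℂ (p.2.1.2 : E) (C p.1 (p.2.1.2 : E))).re ≤ (inner ℂ z (C p.1 z)).re} := by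
    simp only [Set.ofPred_forall]
    exact isClosed_iInter fun z => isClosed_iInter fun _ => isClosed_le (by fun_prop) (by fun_prop)
  have h3 : IsClosed {p : ℝ × (S × S) × S × S | ∀ z z', ‖z‖ = 1 → ‖z'‖ = 1 →
      ‖inner ℂ z (B p.1 z')‖ ≤ ‖inner ℂ (p.2.2.1 : E) (B p.1 (p.2.2.2 : E))‖} := by
    simp only [Set.ofPred_forall]
    exact isClosed_iInter fun z => isClosed_iInter fun _ => isClosed_iInter fun _ =>
      isClosed_iInter fun _ => isClosed_le (by fun_prop) (by fun_prop)
  have h4 : IsClosed {p : ℝ × (S × S) × S × S |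
      ‖inner ℂ (p.2.1.2 : E) (p.2.2.2 : E)‖ ≤ ‖inner ℂ (p.2.1.1 : E) (p.2.2.1 : E)‖} :=
    isClosed_le (by fun_prop) (by fun_prop)
  have hF := (h1.inter (h2.inter h3)).inter h4
  convert isClosedMap_fst_of_compactSpace _ hF using 1
  ext t
  constructor
  · rintro ⟨x, y, v, w, ⟨hx, hy, hvw⟩, hle⟩
    exact ⟨(t, (⟨x, by simpa [S] using hx.1⟩, ⟨y, by simpa [S] using hy.1⟩),
      ⟨v, by simpa [S] using hvw.1⟩, ⟨w, by simpa [S] using hvw.2.1⟩),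
      ⟨⟨hx.2, hy.2, hvw.2.2⟩, hle⟩, rfl⟩
  · rintro ⟨⟨t, ⟨⟨x, hx⟩, ⟨y, hy⟩⟩, ⟨v, hv⟩, ⟨w, hw⟩⟩, ⟨⟨h1, h2, h3⟩, hle⟩, rfl⟩
    simp only [S, mem_sphere_iff_norm, sub_zero] at hx hy hv hw
    exact ⟨x, y, v, w, ⟨⟨hx, h1⟩, ⟨hy, h2⟩, hv, hw, fun z z' => h3 z z'⟩, hle⟩

/-- The effect of a quarter turn: exchanging the two diagonal blocks exchanges the two overlaps. -/
theorem isExtremal_swap {A C B : E →L[ℂ] E} {x y v w : E} (h : IsExtremal A C B x y v w) :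
    IsExtremal C A (-ContinuousLinearMap.adjoint B) y x w v := by
  have key : ∀ v w : E, ‖inner ℂ w ((-ContinuousLinearMap.adjoint B) v)‖ = ‖inner ℂ v (B w)‖ := by
    intro v w
    rw [neg_apply, inner_neg_right, norm_neg,
      ContinuousLinearMap.adjoint_inner_right, ← inner_conj_symm, RCLike.norm_conj]
  refine ⟨h.2.1, h.1, h.2.2.2.1, h.2.2.1, fun w' v' hw hv => ?_⟩
  rw [key, key]
  exact h.2.2.2.2 v' w' hv hw

/-- Along a continuous path of block operators `[[A, B], [B†, C]]` which a shift of the parameter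
takes to the path with the two diagonal blocks exchanged, the extremal vectors can be balanced
somewhere. -/
theorem exists_isExtremal_balanced_of_continuous [Nontrivial E] {A C B : ℝ → E →L[ℂ] E} {s : ℝ}
    (hA : Continuous A) (hC : Continuous C) (hB : Continuous B) (hAs : ∀ t, IsSelfAdjoint (A t))
    (hCs : ∀ t, IsSelfAdjoint (C t)) (hAC : ∀ t, A (t + s) = C t) (hCA : ∀ t, C (t + s) = A t)
    (hBB : ∀ t, B (t + s) = -ContinuousLinearMap.adjoint (B t)) :
    ∃ t x y v w, IsExtremal (A t) (C t) (B t) x y v w ∧ ‖inner ℂ x v‖ = ‖inner ℂ y w‖ := by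
  let P : Set ℝ := {t | ∃ x y v w, IsExtremal (A t) (C t) (B t) x y v w ∧
      ‖inner ℂ y w‖ ≤ ‖inner ℂ x v‖}
  let N : Set ℝ := {t | ∃ x y v w, IsExtremal (A t) (C t) (B t) x y v w ∧
      ‖inner ℂ x v‖ ≤ ‖inner ℂ y w‖}
  have hP : IsClosed P := isClosed_setOf_exists_isExtremal hA hC hB
  have hshift : ∀ t, t ∈ N → t + s ∈ P := by
    rintro t ⟨x, y, v, w, h, hle⟩
    refine ⟨y, x, w, v, ?_, hle⟩
    rw [hAC, hCA, hBB]
    exact isExtremal_swap h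
  have hshift' : ∀ t, t + s ∈ P → t ∈ N := by
    rintro t ⟨x, y, v, w, h, hle⟩
    refine ⟨y, x, w, v, ?_, hle⟩
    rw [hAC, hCA, hBB] at h
    simpa using isExtremal_swap h
  have hshiftP : ∀ t, t ∈ P → t + s ∈ N := by
    rintro t ⟨x, y, v, w, h, hle⟩
    refine ⟨y, x, w, v, ?_, hle⟩
    rw [hAC, hCA, hBB]
    exact isExtremal_swap h
  have hN : IsClosed N := by
    have : N = (fun t => t + s) ⁻¹' P := Set.ext fun t => ⟨hshift t, hshift' t⟩
    rw [this]
    exact hP.preimage (by fun_prop)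
  have hcover : ∀ t, t ∈ P ∨ t ∈ N := by
    intro t
    obtain ⟨x, hx⟩ := exists_isMinUnit (A t)
    obtain ⟨y, hy⟩ := exists_isMinUnit (C t)
    obtain ⟨v, w, hvw⟩ := exists_isMaxPair (B t)
    rcases le_total ‖inner ℂ y w‖ ‖inner ℂ x v‖ with hle | hle
    · exact Or.inl ⟨x, y, v, w, ⟨hx, hy, hvw⟩, hle⟩
    · exact Or.inr ⟨x, y, v, w, ⟨hx, hy, hvw⟩, hle⟩
  have hne : P.Nonempty ∧ N.Nonempty := by
    rcases hcover 0 with h | h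
    · exact ⟨⟨_, h⟩, _, hshiftP _ h⟩
    · exact ⟨⟨_, hshift _ h⟩, _, h⟩
  -- `P` and `N` are nonempty closed sets covering the connected line, so they meet. At a common
  -- parameter both imbalances occur, possibly for different extremal vectors.
  obtain ⟨t, -, ⟨x, y, v, w, h, hle⟩, x', y', v', w', h', hle'⟩ :=
    isPreconnected_closed_iff.1 (isPreconnected_univ (α := ℝ)) P N hP hN (fun t _ => hcover t)
      (by simpa using hne.1) (by simpa using hne.2)
  exact ⟨t, exists_isExtremal_balanced (hAs t) (hCs t) h h' hle hle'⟩

end Extremal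

/-! ### From PPT from spectrum to separability -/

section Blocks

variable {n : ℕ}

/-- The blocks of a matrix in `M_2 ⊗ M_n`. -/
def block (M : BipartiteMatrix 2 n) (a b : Fin 2) : Matrix (Fin n) (Fin n) ℂ :=
  Matrix.of fun i j => M (a, i) (b, j)

theorem blockMatrix_block (M : BipartiteMatrix 2 n) :
    blockMatrix (block M 0 0) (block M 0 1) (block M 1 0) (block M 1 1) = M := by
  ext ⟨a, i⟩ ⟨b, j⟩
  fin_cases a <;> fin_cases b <;> simp [blockMatrix, block]

theorem block_conjTranspose {M : BipartiteMatrix 2 n} (hM : M.IsHermitian) (a b : Fin 2) :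
    (block M a b)ᴴ = block M b a := by
  ext i j
  exact hM.apply _ _

theorem posSemidef_block {M : BipartiteMatrix 2 n} (hM : M.PosSemidef) (a : Fin 2) :
    (block M a a).PosSemidef :=
  hM.submatrix fun i => (a, i)

theorem blockMatrix_mul (A B C D A' B' C' D' : Matrix (Fin n) (Fin n) ℂ) :
    blockMatrix A B C D * blockMatrix A' B' C' D' =
      blockMatrix (A * A' + B * C') (A * B' + B * D') (C * A' + D * C') (C * B' + D * D') := by
  ext ⟨a, i⟩ ⟨b, j⟩
  fin_cases a <;> fin_cases b <;>
    simp [blockMatrix, Matrix.mul_apply, Fintype.sum_prod_type]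

theorem blockMatrix_conjTranspose (A B C D : Matrix (Fin n) (Fin n) ℂ) :
    (blockMatrix A B C D)ᴴ = blockMatrix Aᴴ Cᴴ Bᴴ Dᴴ := by
  ext ⟨a, i⟩ ⟨b, j⟩
  fin_cases a <;> fin_cases b <;> simp [blockMatrix]

theorem blockMatrix_one : blockMatrix (1 : Matrix (Fin n) (Fin n) ℂ) 0 0 1 = 1 := by
  ext ⟨a, i⟩ ⟨b, j⟩
  fin_cases a <;> fin_cases b <;> simp [blockMatrix, Matrix.one_apply]

theorem blockMatrix_smul_one (R : Matrix (Fin 2) (Fin 2) ℂ) :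
    blockMatrix (R 0 0 • (1 : Matrix (Fin n) (Fin n) ℂ)) (R 0 1 • 1) (R 1 0 • 1) (R 1 1 • 1) =
      R ⊗ₖ 1 := by
  ext ⟨a, i⟩ ⟨b, j⟩
  fin_cases a <;> fin_cases b <;> simp [blockMatrix]

/-- The operator of a block on Euclidean space. -/
noncomputable def blockOp (M : BipartiteMatrix 2 n) (a b : Fin 2) :
    EuclideanSpace ℂ (Fin n) →L[ℂ] EuclideanSpace ℂ (Fin n) :=
  Matrix.toEuclideanCLM (n := Fin n) (𝕜 := ℂ) (block M a b)

theorem adjoint_blockOp {M : BipartiteMatrix 2 n} (hM : M.IsHermitian) (a b : Fin 2) :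
    ContinuousLinearMap.adjoint (blockOp M a b) = blockOp M b a := by
  rw [blockOp, ← ContinuousLinearMap.star_eq_adjoint, ← map_star, Matrix.star_eq_conjTranspose,
    block_conjTranspose hM, blockOp]

theorem inner_blockOp (M : BipartiteMatrix 2 n) (a b : Fin 2) (x y : EuclideanSpace ℂ (Fin n)) :
    inner ℂ x (blockOp M a b y) = ∑ i, ∑ j, star (x i) * M (a, i) (b, j) * y j := by
  rw [EuclideanSpace.inner_eq_star_dotProduct, dotProduct_comm]
  simp only [blockOp, Matrix.ofLp_toEuclideanCLM, dotProduct, Matrix.mulVec, Finset.mul_sum]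
  simp [block, mul_assoc]

/-- Conjugating the test vector absorbs the transposes of the blocks. Compared with the form of `M`
itself, the vector indices are swapped against the block indices. -/
theorem star_dotProduct_partialTranspose (M : BipartiteMatrix 2 n)
    (ξ : Fin 2 → EuclideanSpace ℂ (Fin n)) :
    star (fun p : Fin 2 × Fin n => star (ξ p.1 p.2)) ⬝ᵥ
        (partialTranspose M *ᵥ fun p : Fin 2 × Fin n => star (ξ p.1 p.2)) =
      ∑ a, ∑ b, inner ℂ (ξ b) (blockOp M a b (ξ a)) := by
  simp only [dotProduct, Matrix.mulVec, Fintype.sum_prod_type, inner_blockOp, Finset.mul_sum]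
  refine Finset.sum_congr rfl fun a _ => ?_
  rw [Finset.sum_comm]
  refine Finset.sum_congr rfl fun b _ => ?_
  rw [Finset.sum_comm]
  refine Finset.sum_congr rfl fun i _ => Finset.sum_congr rfl fun j _ => ?_
  simp [partialTranspose]
  ring

theorem partialTranspose_isHermitian {M : BipartiteMatrix 2 n} (hM : M.IsHermitian) :
    (partialTranspose M).IsHermitian := by
  ext p q
  exact hM.apply _ _

theorem isPPT_iff {M : BipartiteMatrix 2 n} (hM : M.IsHermitian) :
    IsPPT M ↔ ∀ ξ : Fin 2 → EuclideanSpace ℂ (Fin n),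
      0 ≤ (∑ a, ∑ b, inner ℂ (ξ b) (blockOp M a b (ξ a))).re := by
  rw [IsPPT, Matrix.posSemidef_iff_dotProduct_mulVec]
  constructor
  · rintro ⟨-, h⟩ ξ
    rw [← star_dotProduct_partialTranspose]
    exact (Complex.le_def.1 (h _)).1
  · intro h
    refine ⟨partialTranspose_isHermitian hM, fun ψ => ?_⟩
    have h1 := h fun a => WithLp.toLp 2 fun i => star (ψ (a, i))
    rw [← star_dotProduct_partialTranspose] at h1
    have e : (fun p : Fin 2 × Fin n =>
        star ((WithLp.toLp 2 fun i => star (ψ (p.1, i)) : EuclideanSpace ℂ (Fin n)) p.2)) = ψ := by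
      ext p
      simp
    simp only [e] at h1
    refine Complex.le_def.2 ⟨h1, ?_⟩
    have := (partialTranspose_isHermitian hM).im_star_dotProduct_mulVec_self ψ
    exact this.symm

/-- Cauchy–Schwarz for the partial transpose. For `M` itself `x` and `v` would trade places on the
left; this swap is what PPT adds. -/
theorem IsPPT.norm_inner_sq_le {M : BipartiteMatrix 2 n} (hM : M.IsHermitian) (h : IsPPT M)
    (x v : EuclideanSpace ℂ (Fin n)) :
    ‖inner ℂ v (blockOp M 0 1 x)‖ ^ 2 ≤
      (inner ℂ x (blockOp M 0 0 x)).re * (inner ℂ v (blockOp M 1 1 v)).re := by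
  rw [isPPT_iff hM] at h
  have hz : inner ℂ x (blockOp M 1 0 v) = (starRingEnd ℂ) (inner ℂ v (blockOp M 0 1 x)) := by
    rw [← adjoint_blockOp hM 0 1, ContinuousLinearMap.adjoint_inner_right]
    exact (inner_conj_symm _ _).symm
  set z := inner ℂ v (blockOp M 0 1 x) with hz'
  obtain ⟨ω, hω, hωz⟩ := RCLike.exists_norm_eq_mul_self z
  have hωω : (starRingEnd ℂ) ω * ω = 1 := by
    rw [mul_comm, Complex.mul_conj, Complex.normSq_eq_norm_sq, hω]; simp
  have hr : ∀ r : ℝ, 0 ≤ (inner ℂ x (blockOp M 0 0 x)).re * (r * r) + (-2 * ‖z‖) * r +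
      (inner ℂ v (blockOp M 1 1 v)).re := by
    intro r
    -- The phase `ω` makes the cross terms equal to `-r‖z‖`, so the form is a real quadratic in `r`
    -- whose discriminant cannot be positive.
    have := h ![((-r : ℝ) * ω : ℂ) • x, v]
    simp only [Fin.sum_univ_two, Matrix.cons_val_zero, Matrix.cons_val_one, map_smul,
      inner_smul_left, inner_smul_right, ← hz', hz] at this
    have e1 : (starRingEnd ℂ) ((-r : ℝ) * ω : ℂ) * (((-r : ℝ) * ω : ℂ) *
        inner ℂ x (blockOp M 0 0 x)) = ((r * r : ℝ) : ℂ) * inner ℂ x (blockOp M 0 0 x) := by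
      rw [map_mul, Complex.conj_ofReal]
      push_cast
      linear_combination (r * r * inner ℂ x (blockOp M 0 0 x) : ℂ) * hωω
    have e2 : ((-r : ℝ) * ω : ℂ) * z = ((-r * ‖z‖ : ℝ) : ℂ) := by
      push_cast
      rw [mul_assoc, ← hωz]
      simp
    have e3 : (starRingEnd ℂ) ((-r : ℝ) * ω : ℂ) * (starRingEnd ℂ) z = ((-r * ‖z‖ : ℝ) : ℂ) := by
      rw [← map_mul, e2, Complex.conj_ofReal]
    rw [e1, e2, e3] at this
    simp only [Complex.add_re, Complex.re_ofReal_mul, Complex.ofReal_re] at this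
    linarith
  have := discrim_le_zero hr
  rw [discrim] at this
  linarith

/-- Vectors with equal Gram matrices are related by a unitary. -/
theorem exists_unitary_map_eq {v x y w : EuclideanSpace ℂ (Fin n)} (hvy : ‖v‖ = ‖y‖)
    (hxw : ‖x‖ = ‖w‖) (h : inner ℂ v x = inner ℂ y w) :
    ∃ V ∈ Matrix.unitaryGroup (Fin n) ℂ, Matrix.toEuclideanCLM (n := Fin n) (𝕜 := ℂ) V v = y ∧
      Matrix.toEuclideanCLM (n := Fin n) (𝕜 := ℂ) V x = w := by
  let φ : (ℂ × ℂ) →ₗ[ℂ] EuclideanSpace ℂ (Fin n) :=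
    (LinearMap.toSpanSingleton ℂ _ v).coprod (LinearMap.toSpanSingleton ℂ _ x)
  let ψ : (ℂ × ℂ) →ₗ[ℂ] EuclideanSpace ℂ (Fin n) :=
    (LinearMap.toSpanSingleton ℂ _ y).coprod (LinearMap.toSpanSingleton ℂ _ w)
  have hnorm : ∀ c, ‖φ c‖ = ‖ψ c‖ := by
    intro c
    rw [← sq_eq_sq₀ (norm_nonneg _) (norm_nonneg _)]
    simp only [φ, ψ, LinearMap.coprod_apply, LinearMap.toSpanSingleton_apply,
      @norm_add_sq ℂ, inner_smul_left, inner_smul_right, norm_smul, hvy, hxw, h]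
  -- Equal norms give `φ` and `ψ` the same kernel, so `φ c ↦ ψ c` is a well-defined isometry on the
  -- range of `φ`; it then extends to the whole space.
  obtain ⟨g, hg⟩ := φ.rangeRestrict.exists_rightInverse_of_surjective
    (LinearMap.range_eq_top.2 φ.surjective_rangeRestrict)
  have hg' : ∀ s : LinearMap.range φ, φ (g s) = s := fun s =>
    congrArg Subtype.val (LinearMap.congr_fun hg s)
  have hψ : ∀ c, ψ (g (φ.rangeRestrict c)) = ψ c := by
    intro c
    rw [← sub_eq_zero, ← map_sub, ← norm_eq_zero, ← hnorm, map_sub, hg', norm_eq_zero, sub_eq_zero]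
    rfl
  let L : LinearMap.range φ →ₗᵢ[ℂ] EuclideanSpace ℂ (Fin n) :=
    ⟨ψ ∘ₗ g, fun s => by
      rw [LinearMap.comp_apply, ← hnorm, hg']
      rfl⟩
  have hL : ∀ c, L.extend (φ c) = ψ c := fun c =>
    (L.extend_apply (φ.rangeRestrict c)).trans (hψ c)
  let V := (Matrix.toEuclideanCLM (n := Fin n) (𝕜 := ℂ)).symm L.extend.toContinuousLinearMap
  have hV : Matrix.toEuclideanCLM (n := Fin n) (𝕜 := ℂ) V = L.extend.toContinuousLinearMap :=
    StarAlgEquiv.apply_symm_apply _ _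
  refine ⟨V, ?_, ?_, ?_⟩
  · rw [Matrix.mem_unitaryGroup_iff']
    refine (EquivLike.injective (Matrix.toEuclideanCLM (n := Fin n) (𝕜 := ℂ))) ?_
    rw [map_mul, map_star, hV, map_one, ContinuousLinearMap.star_eq_adjoint]
    exact (ContinuousLinearMap.norm_map_iff_adjoint_comp_self _).1 L.extend.norm_map
  · rw [hV]
    simpa [φ, ψ] using hL (1, 0)
  · rw [hV]
    simpa [φ, ψ] using hL (0, 1)

theorem IsPPTFromSpectrum.conj {m : ℕ} {M : BipartiteMatrix m n} (h : IsPPTFromSpectrum M)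
    {U : BipartiteMatrix m n} (hU : U ∈ Matrix.unitaryGroup (Fin m × Fin n) ℂ) :
    IsPPTFromSpectrum (Uᴴ * M * U) := by
  intro V hV
  have := h (U * V) (mul_mem hU hV)
  simpa [Matrix.conjTranspose_mul, mul_assoc] using this

/-- Conjugation by `1 ⊕ V` replaces `B` by `BV` and `C` by `V†CV`. The overlap condition is what
allows a unitary with `V v = y` and `V x = ω w`, so that the PPT inequality at `x`, `v` becomes the
one claimed. -/
theorem IsPPTFromSpectrum.norm_inner_sq_le {M : BipartiteMatrix 2 n} (hM : M.IsHermitian)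
    (h : IsPPTFromSpectrum M) {x y v w : EuclideanSpace ℂ (Fin n)} (hx : ‖x‖ = 1) (hy : ‖y‖ = 1)
    (hv : ‖v‖ = 1) (hw : ‖w‖ = 1) (hxv : ‖inner ℂ x v‖ = ‖inner ℂ y w‖) :
    ‖inner ℂ v (blockOp M 0 1 w)‖ ^ 2 ≤
      (inner ℂ x (blockOp M 0 0 x)).re * (inner ℂ y (blockOp M 1 1 y)).re := by
  obtain ⟨ω, hω, hωe⟩ : ∃ ω : ℂ, ‖ω‖ = 1 ∧ inner ℂ v x = inner ℂ y (ω • w) := by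
    obtain ⟨c, hc, hce⟩ := RCLike.exists_norm_eq_mul_self (inner ℂ v x)
    obtain ⟨d, hd, hde⟩ := RCLike.exists_norm_eq_mul_self (inner ℂ y w)
    have hc0 : c ≠ 0 := fun h0 => by simp [h0] at hc
    -- The quotient of the phases of `⟨v, x⟩` and `⟨y, w⟩`.
    refine ⟨c⁻¹ * d, by simp [hc, hd], ?_⟩
    rw [inner_smul_right, mul_assoc, ← hde, ← hxv, norm_inner_symm, hce, inv_mul_cancel_left₀ hc0]
  obtain ⟨V, hV, hVv, hVx⟩ := exists_unitary_map_eq (hv.trans hy.symm)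
    (show ‖x‖ = ‖ω • w‖ by rw [norm_smul, hω, hx, hw, one_mul]) hωe
  set W := Matrix.toEuclideanCLM (n := Fin n) (𝕜 := ℂ) V with hW
  have hU : blockMatrix 1 0 0 V ∈ Matrix.unitaryGroup (Fin 2 × Fin n) ℂ := by
    rw [Matrix.mem_unitaryGroup_iff'] at hV ⊢
    rw [Matrix.star_eq_conjTranspose] at hV ⊢
    rw [blockMatrix_conjTranspose, blockMatrix_mul, ← blockMatrix_one]
    simp [hV]
  have hN : (blockMatrix 1 0 0 V)ᴴ * M * blockMatrix 1 0 0 V =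
      blockMatrix (block M 0 0) (block M 0 1 * V) (Vᴴ * block M 1 0) (Vᴴ * block M 1 1 * V) := by
    conv_lhs => rw [← blockMatrix_block M]
    rw [blockMatrix_conjTranspose, blockMatrix_mul, blockMatrix_mul]
    simp [mul_assoc]
  have hNh := Matrix.isHermitian_conjTranspose_mul_mul (blockMatrix 1 0 0 V) hM
  have key := (h _ hU).norm_inner_sq_le hNh x v
  rw [hN] at key
  have e0 : blockOp (blockMatrix (block M 0 0) (block M 0 1 * V) (Vᴴ * block M 1 0)
      (Vᴴ * block M 1 1 * V)) 0 0 = blockOp M 0 0 := rfl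
  have e1 : blockOp (blockMatrix (block M 0 0) (block M 0 1 * V) (Vᴴ * block M 1 0)
      (Vᴴ * block M 1 1 * V)) 0 1 x = blockOp M 0 1 (ω • w) := by
    rw [← hVx]
    exact DFunLike.congr_fun (map_mul (Matrix.toEuclideanCLM (n := Fin n) (𝕜 := ℂ)) _ _) x
  have e2 : blockOp (blockMatrix (block M 0 0) (block M 0 1 * V) (Vᴴ * block M 1 0)
      (Vᴴ * block M 1 1 * V)) 1 1 v = ContinuousLinearMap.adjoint W (blockOp M 1 1 y) := by
    have : blockOp (blockMatrix (block M 0 0) (block M 0 1 * V) (Vᴴ * block M 1 0)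
      (Vᴴ * block M 1 1 * V)) 1 1 = star W * blockOp M 1 1 * W := by
      change Matrix.toEuclideanCLM (n := Fin n) (𝕜 := ℂ) (star V * block M 1 1 * V) = _
      rw [map_mul, map_mul, map_star]
      rfl
    rw [this, ← hVv]
    rfl
  rw [e0, e1, e2, map_smul, inner_smul_right, norm_mul, hω, one_mul,
    ContinuousLinearMap.adjoint_inner_right, hVv] at key
  exact key

theorem rotation_conj (M : BipartiteMatrix 2 n) (c s : ℝ) :
    ((!![(c : ℂ), -s; s, c] ⊗ₖ (1 : Matrix (Fin n) (Fin n) ℂ))ᴴ * M *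
      (!![(c : ℂ), -s; s, c] ⊗ₖ (1 : Matrix (Fin n) (Fin n) ℂ))) =
    blockMatrix
      (((c * c : ℝ) : ℂ) • block M 0 0 + ((c * s : ℝ) : ℂ) • (block M 0 1 + block M 1 0) +
        ((s * s : ℝ) : ℂ) • block M 1 1)
      (((c * s : ℝ) : ℂ) • (block M 1 1 - block M 0 0) + ((c * c : ℝ) : ℂ) • block M 0 1 -
        ((s * s : ℝ) : ℂ) • block M 1 0)
      (((c * s : ℝ) : ℂ) • (block M 1 1 - block M 0 0) + ((c * c : ℝ) : ℂ) • block M 1 0 -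
        ((s * s : ℝ) : ℂ) • block M 0 1)
      (((s * s : ℝ) : ℂ) • block M 0 0 - ((c * s : ℝ) : ℂ) • (block M 0 1 + block M 1 0) +
        ((c * c : ℝ) : ℂ) • block M 1 1) := by
  conv_lhs => rw [← blockMatrix_block M]
  rw [← blockMatrix_smul_one, blockMatrix_conjTranspose, blockMatrix_mul, blockMatrix_mul]
  congr 1 <;> ext i j <;> simp <;> ring

theorem rotation_mem_unitaryGroup (t : ℝ) :
    !![(Real.cos t : ℂ), -Real.sin t; Real.sin t, Real.cos t] ∈
      Matrix.unitaryGroup (Fin 2) ℂ := by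
  have h : (Real.sin t : ℂ) * Real.sin t + Real.cos t * Real.cos t = 1 := by
    exact_mod_cast (by simpa [sq] using Real.sin_sq_add_cos_sq t :
      Real.sin t * Real.sin t + Real.cos t * Real.cos t = 1)
  rw [Matrix.mem_unitaryGroup_iff]
  ext i j
  fin_cases i <;> fin_cases j <;>
    simp [Matrix.mul_apply, Fin.sum_univ_two, -Complex.ofReal_cos, -Complex.ofReal_sin]
  · linear_combination h
  · ring
  · ring
  · linear_combination h

theorem posSemidef_sub_smul_one_of_isMinUnit {A : Matrix (Fin n) (Fin n) ℂ} (hA : A.IsHermitian)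
    {x : EuclideanSpace ℂ (Fin n)}
    (hx : IsMinUnit (Matrix.toEuclideanCLM (n := Fin n) (𝕜 := ℂ) A) x) :
    (A - (((inner ℂ x (Matrix.toEuclideanCLM (n := Fin n) (𝕜 := ℂ) A x)).re : ℝ) : ℂ) •
      1).PosSemidef := by
  set a := (inner ℂ x (Matrix.toEuclideanCLM (n := Fin n) (𝕜 := ℂ) A x)).re
  have hH : (A - (a : ℂ) • 1).IsHermitian := by
    refine hA.sub ?_
    simp [Matrix.IsHermitian, Matrix.conjTranspose_smul]
  refine .of_dotProduct_mulVec_nonneg hH fun u => ?_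
  refine Complex.le_def.2 ⟨?_, (hH.im_star_dotProduct_mulVec_self u).symm⟩
  by_cases hu : u = 0
  · simp [hu]
  set z : EuclideanSpace ℂ (Fin n) := WithLp.toLp 2 u
  have hz : z ≠ 0 := by simpa [z] using hu
  have hmin := hx.2 ((‖z‖ : ℂ)⁻¹ • z) (norm_smul_inv_norm hz)
  have hz' : 0 < ‖z‖ := norm_pos_iff.2 hz
  have hinner : inner ℂ z (Matrix.toEuclideanCLM (n := Fin n) (𝕜 := ℂ) A z) =
      star u ⬝ᵥ (A *ᵥ u) := by
    rw [EuclideanSpace.inner_eq_star_dotProduct, dotProduct_comm]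
    rfl
  have hself : star u ⬝ᵥ u = ((‖z‖ ^ 2 : ℝ) : ℂ) := by
    have := inner_self_eq_norm_sq_to_K (𝕜 := ℂ) z
    rw [EuclideanSpace.inner_eq_star_dotProduct, dotProduct_comm] at this
    rw [Complex.ofReal_pow]
    exact this
  rw [map_smul, inner_smul_left, inner_smul_right, hinner, ← mul_assoc] at hmin
  have e : (starRingEnd ℂ) (‖z‖ : ℂ)⁻¹ * (‖z‖ : ℂ)⁻¹ = ((‖z‖⁻¹ ^ 2 : ℝ) : ℂ) := by
    rw [map_inv₀, Complex.conj_ofReal]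
    push_cast
    ring
  rw [e, Complex.re_ofReal_mul] at hmin
  change a ≤ _ at hmin
  rw [inv_pow, inv_mul_eq_div, le_div_iff₀ (by positivity)] at hmin
  rw [Matrix.sub_mulVec, Matrix.smul_mulVec, Matrix.one_mulVec, dotProduct_sub, dotProduct_smul,
    hself]
  simp only [Complex.zero_re, Complex.sub_re, smul_eq_mul, ← Complex.ofReal_mul,
    Complex.ofReal_re]
  linarith

/-- At a balanced rotation angle the inequality for extremal vectors bounds `‖B‖²` by the product of
the smallest eigenvalues of the diagonal blocks, so the rotated matrix is in the cone, and rotating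
back keeps it there. -/
theorem mem_separableCone_of_isPPTFromSpectrum (hn : n ≠ 0) {M : BipartiteMatrix 2 n}
    (hM : M.PosSemidef) (h : IsPPTFromSpectrum M) : M ∈ separableCone 2 n := by
  have : NeZero n := ⟨hn⟩
  let R : ℝ → BipartiteMatrix 2 n := fun t =>
    !![(Real.cos t : ℂ), -Real.sin t; Real.sin t, Real.cos t] ⊗ₖ (1 : Matrix (Fin n) (Fin n) ℂ)
  have hR : ∀ t, R t ∈ Matrix.unitaryGroup (Fin 2 × Fin n) ℂ := fun t =>
    Matrix.kronecker_mem_unitary (rotation_mem_unitaryGroup t) (one_mem _)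
  let N : ℝ → BipartiteMatrix 2 n := fun t => (R t)ᴴ * M * R t
  have hN : ∀ t, (N t).PosSemidef := fun t => hM.conjTranspose_mul_mul_same (R t)
  have hblk : ∀ t, N t = _ := fun t => rotation_conj M (Real.cos t) (Real.sin t)
  have h00 : ∀ t, block (N t) 0 0 = _ := fun t => congrArg (fun X => block X 0 0) (hblk t)
  have h01 : ∀ t, block (N t) 0 1 = _ := fun t => congrArg (fun X => block X 0 1) (hblk t)
  have h11 : ∀ t, block (N t) 1 1 = _ := fun t => congrArg (fun X => block X 1 1) (hblk t)
  have h10 : ∀ t, block (N t) 1 0 = _ := fun t => congrArg (fun X => block X 1 0) (hblk t)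
  have hblkc : ∀ (A B C D : Matrix (Fin n) (Fin n) ℂ), block (blockMatrix A B C D) 0 0 = A ∧
    block (blockMatrix A B C D) 0 1 = B ∧ block (blockMatrix A B C D) 1 0 = C ∧
    block (blockMatrix A B C D) 1 1 = D := fun _ _ _ _ => ⟨rfl, rfl, rfl, rfl⟩
  simp only [hblkc] at h00 h01 h10 h11
  have hsa : ∀ t a, IsSelfAdjoint (blockOp (N t) a a) := fun t a => by
    rw [ContinuousLinearMap.isSelfAdjoint_iff', adjoint_blockOp (hN t).isHermitian]
  have hlin : Continuous (fun X : Matrix (Fin n) (Fin n) ℂ =>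
      Matrix.toEuclideanCLM (n := Fin n) (𝕜 := ℂ) X) :=
    LinearMap.continuous_of_finiteDimensional
      (Matrix.toEuclideanCLM (n := Fin n) (𝕜 := ℂ)).toAlgEquiv.toLinearMap
  have hc00 : Continuous fun t => blockOp (N t) 0 0 := by
    refine hlin.comp ?_
    simp only [h00]
    fun_prop
  have hc11 : Continuous fun t => blockOp (N t) 1 1 := by
    refine hlin.comp ?_
    simp only [h11]
    fun_prop
  have hc01 : Continuous fun t => blockOp (N t) 0 1 := by
    refine hlin.comp ?_
    simp only [h01]
    fun_prop
  obtain ⟨t, x, y, v, w, ⟨hx, hy, hvw⟩, hxy⟩ := exists_isExtremal_balanced_of_continuous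
    (s := Real.pi / 2) hc00 hc11 hc01 (fun t => hsa t 0) (fun t => hsa t 1)
    (fun t => by
      simp only [blockOp, h00, h11, Real.cos_add_pi_div_two, Real.sin_add_pi_div_two]
      congr 1
      simp only [mul_neg, neg_neg, Complex.ofReal_neg, neg_smul, mul_comm]
      abel)
    (fun t => by
      simp only [blockOp, h00, h11, Real.cos_add_pi_div_two, Real.sin_add_pi_div_two]
      congr 1
      simp only [mul_neg, neg_neg, Complex.ofReal_neg, neg_smul, mul_comm]
      abel)
    (fun t => by
      rw [adjoint_blockOp (hN t).isHermitian]
      simp only [blockOp, h01, h10, Real.cos_add_pi_div_two, Real.sin_add_pi_div_two]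
      rw [← map_neg]
      congr 1
      simp only [mul_neg, neg_neg, Complex.ofReal_neg, neg_smul, mul_comm]
      abel)
  have key := (h.conj (hR t)).norm_inner_sq_le (hN t).isHermitian hx.1 hy.1 hvw.1 hvw.2.1 hxy
  have hpos : ∀ a z, 0 ≤ (inner ℂ z (blockOp (N t) a a z)).re := fun a z => by
    have := (posSemidef_block (hN t) a).dotProduct_mulVec_nonneg z.ofLp
    rw [EuclideanSpace.inner_eq_star_dotProduct, dotProduct_comm]
    exact (Complex.le_def.1 this).1
  have hmem : N t ∈ separableCone 2 n := by
    rw [← blockMatrix_block (N t), ← block_conjTranspose (hN t).isHermitian 0 1]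
    refine blockMatrix_mem_separableCone (hpos 0 x) (hpos 1 y)
      (posSemidef_sub_smul_one_of_isMinUnit (posSemidef_block (hN t) 0).isHermitian hx)
      (posSemidef_sub_smul_one_of_isMinUnit (posSemidef_block (hN t) 1).isHermitian hy)
      fun v' w' hv' hw' => ?_
    refine le_trans ?_ key
    gcongr
    exact hvw.2.2 v' w' hv' hw'
  have := conj_kronecker_mem_separableCone hmem
    !![(Real.cos t : ℂ), -Real.sin t; Real.sin t, Real.cos t]
  have hRR : R t * (R t)ᴴ = 1 := Matrix.mem_unitaryGroup_iff.1 (hR t)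
  change R t * ((R t)ᴴ * M * R t) * (R t)ᴴ ∈ _ at this
  rwa [mul_assoc, mul_assoc, hRR, mul_one, ← mul_assoc, hRR, one_mul] at this

end Blocks

/-! ### Eigenvalue bounds on orthonormal quadruples -/

section Spectrum

variable {H : Type*} [NormedAddCommGroup H] [InnerProductSpace ℂ H]

theorem re_inner_apply_eq_sum {ι : Type*} [Fintype ι] (g : OrthonormalBasis ι ℂ H)
    {T : H →L[ℂ] H} {μ : ι → ℝ} (hT : ∀ i, T (g i) = (μ i : ℂ) • g i) (x : H) :
    (inner ℂ x (T x)).re = ∑ i, μ i * ‖inner ℂ (g i) x‖ ^ 2 := by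
  have h1 : T x = ∑ i, (inner ℂ (g i) x * μ i) • g i := by
    conv_lhs => rw [← g.sum_repr' x, map_sum]
    refine Finset.sum_congr rfl fun i _ => ?_
    rw [map_smul, hT, smul_smul]
  rw [h1, inner_sum, Complex.re_sum]
  refine Finset.sum_congr rfl fun i _ => ?_
  rw [inner_smul_right, ← inner_conj_symm x (g i)]
  have : inner ℂ (g i) x * (μ i : ℂ) * (starRingEnd ℂ) (inner ℂ (g i) x) =
      ((μ i * ‖inner ℂ (g i) x‖ ^ 2 : ℝ) : ℂ) := by
    rw [mul_right_comm, Complex.mul_conj, Complex.normSq_eq_norm_sq]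
    push_cast
    ring
  rw [this, Complex.ofReal_re]

/-- Ky Fan's minimum principle. -/
theorem sum_eigenvalues_le_sum_re_inner {ι κ : Type*} [Fintype ι] [DecidableEq ι] [Fintype κ]
    (g : OrthonormalBasis ι ℂ H) {T : H →L[ℂ] H} {μ : ι → ℝ}
    (hT : ∀ i, T (g i) = (μ i : ℂ) • g i) {h : κ → H} (hh : Orthonormal ℂ h) {S : Finset ι}
    (hS : S.card = Fintype.card κ) {m : ℝ} (hle : ∀ i ∈ S, μ i ≤ m) (hge : ∀ i ∉ S, m ≤ μ i) :
    ∑ i ∈ S, μ i ≤ ∑ j, (inner ℂ (h j) (T (h j))).re := by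
  simp_rw [re_inner_apply_eq_sum g hT]
  rw [Finset.sum_comm]
  simp_rw [← Finset.mul_sum]
  set d : ι → ℝ := fun i => ∑ j, ‖inner ℂ (g i) (h j)‖ ^ 2 with hd
  have hd0 : ∀ i, 0 ≤ d i := fun i => Finset.sum_nonneg fun j _ => sq_nonneg _
  have hd1 : ∀ i, d i ≤ 1 := by
    intro i
    have := hh.sum_inner_products_le (g i) (s := Finset.univ)
    simp_rw [norm_inner_symm (h _) (g i)] at this
    simpa [g.norm_eq_one] using this
  have hsum : ∑ i, d i = S.card := by
    rw [hd, Finset.sum_comm, hS]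
    simp [g.sum_sq_norm_inner_right, hh.norm_eq_one]
  -- The weights `d i` lie in `[0, 1]` by Bessel and have total `S.card`; measured from the
  -- threshold `m`, the sum is least when all weight sits on `S`.
  have key : ∑ i, (if i ∈ S then μ i - m else 0) ≤ ∑ i, (μ i - m) * d i := by
    refine Finset.sum_le_sum fun i _ => ?_
    split_ifs with hi
    · nlinarith [hle i hi, hd1 i]
    · exact mul_nonneg (sub_nonneg.2 (hge i hi)) (hd0 i)
  rw [Finset.sum_ite_mem, Finset.univ_inter, Finset.sum_sub_distrib, Finset.sum_const] at key
  simp_rw [sub_mul] at key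
  rw [Finset.sum_sub_distrib, ← Finset.mul_sum, hsum, nsmul_eq_mul] at key
  change ∑ i ∈ S, μ i ≤ ∑ i, μ i * d i
  linarith

theorem re_inner_apply_le {ι : Type*} [Fintype ι] (g : OrthonormalBasis ι ℂ H)
    {T : H →L[ℂ] H} {μ : ι → ℝ} (hT : ∀ i, T (g i) = (μ i : ℂ) • g i) {m : ℝ}
    (hm : ∀ i, μ i ≤ m) {x : H} (hx : ‖x‖ = 1) : (inner ℂ x (T x)).re ≤ m := by
  rw [re_inner_apply_eq_sum g hT]
  calc ∑ i, μ i * ‖inner ℂ (g i) x‖ ^ 2 ≤ ∑ i, m * ‖inner ℂ (g i) x‖ ^ 2 :=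
        Finset.sum_le_sum fun i _ => mul_le_mul_of_nonneg_right (hm i) (sq_nonneg _)
    _ = m := by rw [← Finset.mul_sum, g.sum_sq_norm_inner_right, hx]; ring

/-- Replacing two members of an orthonormal quadruple by their normalised sum and difference. -/
theorem orthonormal_sum_sub {f : Fin 4 → H} (hf : Orthonormal ℂ f) :
    Orthonormal ℂ ![f 0, ((√2)⁻¹ : ℂ) • (f 1 + f 2), ((√2)⁻¹ : ℂ) • (f 1 - f 2), f 3] := by
  have h2 : ((√2)⁻¹ : ℂ) * ((√2)⁻¹ : ℂ) = 1 / 2 := by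
    rw [← mul_inv]
    norm_cast
    rw [Real.mul_self_sqrt (by norm_num)]
    simp
  have e := orthonormal_iff_ite.1 hf
  rw [orthonormal_iff_ite]
  intro i j
  fin_cases i <;> fin_cases j <;>
    simp [inner_add_left, inner_add_right, inner_sub_left, inner_sub_right, inner_smul_left,
      inner_smul_right, e, -inner_self_eq_norm_sq_to_K]
  all_goals linear_combination 2 * h2

theorem polarization_sum_sub {T : H →L[ℂ] H} (hT : (T : H →ₗ[ℂ] H).IsSymmetric) (x y : H) :
    (inner ℂ (((√2)⁻¹ : ℂ) • (x + y)) (T (((√2)⁻¹ : ℂ) • (x + y)))).re -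
      (inner ℂ (((√2)⁻¹ : ℂ) • (x - y)) (T (((√2)⁻¹ : ℂ) • (x - y)))).re =
      2 * (inner ℂ x (T y)).re := by
  have h2 : ((√2)⁻¹ : ℝ) * ((√2)⁻¹ : ℝ) = 1 / 2 := by
    rw [← mul_inv, Real.mul_self_sqrt (by norm_num)]
    simp
  have hs : ∀ z : H, (inner ℂ (((√2)⁻¹ : ℂ) • z) (T (((√2)⁻¹ : ℂ) • z))).re =
      1 / 2 * (inner ℂ z (T z)).re := by
    intro z
    rw [map_smul, inner_smul_left, inner_smul_right, ← mul_assoc, ← Complex.ofReal_inv,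
      Complex.conj_ofReal, ← Complex.ofReal_mul, h2, Complex.re_ofReal_mul]
  have hyx : (inner ℂ y (T x)).re = (inner ℂ x (T y)).re := by
    rw [← inner_conj_symm, Complex.conj_re]
    exact congrArg Complex.re (hT x y)
  rw [hs, hs]
  simp only [map_add, map_sub, inner_add_left, inner_add_right, inner_sub_left, inner_sub_right,
    Complex.add_re, Complex.sub_re]
  rw [hyx]
  ring

/-- Polarisation turns the cross term into `cs(⟨p, T p⟩ - ⟨q, T q⟩)`. The subtracted term is at most
`λ_1`; the others, with weights `c² ≥ cs ≥ s²`, are bounded below by the three smallest eigenvalues.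
-/
theorem weighted_form_nonneg_of_le {N : ℕ} (g : OrthonormalBasis (Fin N) ℂ H) {T : H →L[ℂ] H}
    (hTs : (T : H →ₗ[ℂ] H).IsSymmetric) {μ : Fin N → ℝ} (hμ : Antitone μ) (hμ0 : ∀ i, 0 ≤ μ i)
    (hT : ∀ i, T (g i) = (μ i : ℂ) • g i) (hN : 4 ≤ N)
    (hcond : μ ⟨0, by omega⟩ ≤ μ ⟨N - 2, by omega⟩ +
      2 * √(μ ⟨N - 3, by omega⟩ * μ ⟨N - 1, by omega⟩))
    {f : Fin 4 → H} (hf : Orthonormal ℂ f) {c s : ℝ} (hs : 0 ≤ s) (hsc : s ≤ c) :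
    0 ≤ c ^ 2 * (inner ℂ (f 0) (T (f 0))).re + s ^ 2 * (inner ℂ (f 3) (T (f 3))).re +
      2 * (c * s) * (inner ℂ (f 1) (T (f 2))).re := by
  have hF := orthonormal_sum_sub hf
  have hpol := polarization_sum_sub hTs (f 1) (f 2)
  set p := ((√2)⁻¹ : ℂ) • (f 1 + f 2)
  set q := ((√2)⁻¹ : ℂ) • (f 1 - f 2)
  have hq : (inner ℂ q (T q)).re ≤ μ ⟨0, by omega⟩ :=
    re_inner_apply_le g hT (fun i => hμ (Fin.mk_le_mk.2 (Nat.zero_le _))) (hF.1 2)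
  have hF3 : Orthonormal ℂ ![f 0, p, f 3] := by
    convert hF.comp ![0, 1, 3] (by decide) using 1
    ext i; fin_cases i <;> rfl
  have hF2 : Orthonormal ℂ ![f 0, p] := by
    convert hF.comp ![0, 1] (by decide) using 1
    ext i; fin_cases i <;> rfl
  have hF1 : Orthonormal ℂ ![f 0] := by
    convert hF.comp ![0] (by decide) using 1
    ext i; fin_cases i; rfl
  let a : Fin N := ⟨N - 3, by omega⟩
  let b : Fin N := ⟨N - 2, by omega⟩
  let d : Fin N := ⟨N - 1, by omega⟩
  have hab : a ≠ b := by simp [a, b]; omega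
  have had : a ≠ d := by simp [a, d]; omega
  have hbd : b ≠ d := by simp [b, d]; omega
  have k1 := sum_eigenvalues_le_sum_re_inner g hT hF1 (S := {d}) (by simp) (m := μ d)
    (by simp) (fun i _ => hμ (by simp only [d, Fin.le_def]; omega))
  have k2 := sum_eigenvalues_le_sum_re_inner g hT hF2 (S := {b, d}) (by simp [hbd]) (m := μ b)
    (by
      intro i hi
      simp only [Finset.mem_insert, Finset.mem_singleton] at hi
      rcases hi with rfl | rfl
      · exact le_rfl
      · exact hμ (by simp only [b, d, Fin.le_def]; omega))
    (fun i hi => hμ (by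
      simp only [Finset.mem_insert, Finset.mem_singleton, b, d, Fin.ext_iff] at hi
      simp only [b, Fin.le_def]; omega))
  have k3 := sum_eigenvalues_le_sum_re_inner g hT hF3 (S := {a, b, d}) (by simp [hab, had, hbd])
    (m := μ a)
    (by
      intro i hi
      simp only [Finset.mem_insert, Finset.mem_singleton] at hi
      rcases hi with rfl | rfl | rfl
      · exact le_rfl
      · exact hμ (by simp only [a, b, Fin.le_def]; omega)
      · exact hμ (by simp only [a, d, Fin.le_def]; omega))
    (fun i hi => hμ (by
      simp only [Finset.mem_insert, Finset.mem_singleton, a, b, d, Fin.ext_iff] at hi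
      simp only [a, Fin.le_def]; omega))
  simp [Fin.sum_univ_three, hab, had, hbd, Finset.sum_insert] at k1 k2 k3
  have hcond' : μ ⟨0, by omega⟩ ≤ μ b + 2 * (√(μ a) * √(μ d)) := by
    rw [← Real.sqrt_mul (hμ0 a)]
    exact hcond
  have hsqa := Real.sq_sqrt (hμ0 a)
  have hsqd := Real.sq_sqrt (hμ0 d)
  have hcs : 0 ≤ c * s := mul_nonneg (hs.trans hsc) hs
  -- Abel summation: `k3`, `k2`, `k1` with the nonnegative weights `s²`, `s(c - s)`, `c(c - s)` add
  -- up to the lower bound `c² μ_d + cs μ_b + s² μ_a`. Together with the criterion this leaves the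
  -- square in `i5`.
  have i1 := mul_le_mul_of_nonneg_left k3 (sq_nonneg s)
  have i2 := mul_le_mul_of_nonneg_left k2 (mul_nonneg hs (sub_nonneg.2 hsc))
  have i3 := mul_le_mul_of_nonneg_left k1 (mul_nonneg (hs.trans hsc) (sub_nonneg.2 hsc))
  have i4 := mul_le_mul_of_nonneg_left (hq.trans hcond') hcs
  have i5 := sq_nonneg (c * √(μ d) - s * √(μ a))
  have i6 : (c * √(μ d) - s * √(μ a)) ^ 2 =
      c ^ 2 * μ d + s ^ 2 * μ a - 2 * (c * s) * (√(μ a) * √(μ d)) := by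
    rw [← hsqa, ← hsqd]
    simp only [Real.sqrt_sq (Real.sqrt_nonneg _)]
    ring
  rw [mul_assoc 2, mul_left_comm 2, ← hpol]
  linarith

/-- The form is symmetric under exchanging `f 0` with `f 3` and `c` with `s`, so the order of the
weights is immaterial. -/
theorem weighted_form_nonneg {N : ℕ} (g : OrthonormalBasis (Fin N) ℂ H) {T : H →L[ℂ] H}
    (hTs : (T : H →ₗ[ℂ] H).IsSymmetric) {μ : Fin N → ℝ} (hμ : Antitone μ) (hμ0 : ∀ i, 0 ≤ μ i)
    (hT : ∀ i, T (g i) = (μ i : ℂ) • g i) (hN : 4 ≤ N)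
    (hcond : μ ⟨0, by omega⟩ ≤ μ ⟨N - 2, by omega⟩ +
      2 * √(μ ⟨N - 3, by omega⟩ * μ ⟨N - 1, by omega⟩))
    {f : Fin 4 → H} (hf : Orthonormal ℂ f) {c s : ℝ} (hc : 0 ≤ c) (hs : 0 ≤ s) :
    0 ≤ c ^ 2 * (inner ℂ (f 0) (T (f 0))).re + s ^ 2 * (inner ℂ (f 3) (T (f 3))).re +
      2 * (c * s) * (inner ℂ (f 1) (T (f 2))).re := by
  rcases le_total s c with h | h
  · exact weighted_form_nonneg_of_le g hTs hμ hμ0 hT hN hcond hf hs h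
  · have hf' : Orthonormal ℂ ![f 3, f 1, f 2, f 0] := by
      convert hf.comp ![3, 1, 2, 0] (by decide) using 1
      ext i; fin_cases i <;> rfl
    have := weighted_form_nonneg_of_le g hTs hμ hμ0 hT hN hcond hf' hc h
    simp only [Matrix.cons_val] at this
    linarith

theorem exists_orthonormalBasis_extending {ι κ : Type*} [Fintype ι] [FiniteDimensional ℂ H]
    (hι : Module.finrank ℂ H = Fintype.card ι) {f : κ → H} (hf : Orthonormal ℂ f)
    {e : κ → ι} (he : Function.Injective e) :
    ∃ b : OrthonormalBasis ι ℂ H, ∀ k, b (e k) = f k := by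
  have hv : Orthonormal ℂ ((Set.range e).domRestrict (Function.extend e f 0)) := by
    have : (Set.range e).domRestrict (Function.extend e f 0) =
        f ∘ (Equiv.ofInjective e he).symm := by
      ext ⟨_, k, rfl⟩
      simp [Set.domRestrict, he.extend_apply]
    rw [this]
    exact hf.comp _ (Equiv.injective _)
  obtain ⟨b, hb⟩ := hv.exists_orthonormalBasis_extension_of_card_eq hι
  exact ⟨b, fun k => by rw [hb _ ⟨k, rfl⟩, he.extend_apply]⟩

end Spectrum

/-! ### PPT from spectrum and the eigenvalue criterion -/

section PartialTransposeFromSpectrum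

variable {n : ℕ}

theorem exists_sorted_eigenbasis {m n : ℕ} {ρ : BipartiteMatrix m n} (hρ : ρ.IsHermitian) :
    ∃ g : OrthonormalBasis (Fin (m * n)) ℂ (EuclideanSpace ℂ (Fin m × Fin n)),
      ∀ i, Matrix.toEuclideanCLM (n := Fin m × Fin n) (𝕜 := ℂ) ρ (g i) =
        (sortedEigenvalue hρ i : ℂ) • g i := by
  let e : Fin (m * n) ≃ Fin m × Fin n :=
    (finCongr (by simp)).trans (Fintype.equivOfCardEq (Fintype.card_fin _))
  refine ⟨hρ.eigenvectorBasis.reindex e.symm, fun i => ?_⟩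
  rw [OrthonormalBasis.reindex_apply, Equiv.symm_symm]
  have h := hρ.mulVec_eigenvectorBasis (e i)
  have he : hρ.eigenvalues (e i) = sortedEigenvalue hρ i := by
    simp [Matrix.IsHermitian.eigenvalues, sortedEigenvalue, e]
  rw [he] at h
  exact congrArg (WithLp.toLp 2) h

theorem inner_orthonormalBasis_toMatrix {ι : Type*} [Fintype ι] [DecidableEq ι]
    (M : Matrix ι ι ℂ) (u : OrthonormalBasis ι ℂ (EuclideanSpace ℂ ι)) :
    ∃ U ∈ Matrix.unitaryGroup ι ℂ, ∀ p q,
      (Uᴴ * M * U) p q = inner ℂ (u p) (Matrix.toEuclideanCLM (n := ι) (𝕜 := ℂ) M (u q)) := by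
  refine ⟨_, (EuclideanSpace.basisFun ι ℂ).toMatrix_orthonormalBasis_mem_unitary u, fun p q => ?_⟩
  rw [EuclideanSpace.inner_eq_star_dotProduct, dotProduct_comm]
  rw [mul_assoc, Matrix.mul_apply, dotProduct]
  refine Finset.sum_congr rfl fun k _ => ?_
  congr 1

theorem inner_single_blockOp (M : BipartiteMatrix 2 n) (a b : Fin 2) (i j : Fin n) :
    inner ℂ (EuclideanSpace.single i (1 : ℂ)) (blockOp M a b (EuclideanSpace.single j 1)) =
      M (a, i) (b, j) := by
  rw [inner_blockOp, Finset.sum_eq_single i, Finset.sum_eq_single j]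
  · simp
  · intro k _ hk
    simp [hk]
  · simp
  · intro k _ hk
    simp [hk]
  · simp

/-- The extremal unitary places the eigenvectors of `λ_{2n}` and `λ_{2n-2}` at `e_0 ⊗ e_0` and `e_1
⊗ e_1`, and the normalised sum and difference of those of `λ_1` and `λ_{2n-1}` at `e_0 ⊗ e_1` and
`e_1 ⊗ e_0`. The relevant off-diagonal entry is `(λ_1 - λ_{2n-1})/2`, and the PPT inequality gives
the criterion. -/
theorem sortedEigenvalue_le_of_isPPTFromSpectrum (hn : 2 ≤ n) (h0 : 0 < 2 * n)
    (h1 : 2 * n - 1 < 2 * n)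
    (h2 : 2 * n - 2 < 2 * n) (h3 : 2 * n - 3 < 2 * n) {ρ : BipartiteMatrix 2 n}
    (hρ : ρ.IsHermitian) (h : IsPPTFromSpectrum ρ) :
    sortedEigenvalue hρ ⟨0, h0⟩ ≤ sortedEigenvalue hρ ⟨2 * n - 2, h2⟩ +
      2 * √(sortedEigenvalue hρ ⟨2 * n - 3, h3⟩ *
        sortedEigenvalue hρ ⟨2 * n - 1, h1⟩) := by
  obtain ⟨g, hg⟩ := exists_sorted_eigenbasis hρ
  set μ := sortedEigenvalue hρ
  set T := Matrix.toEuclideanCLM (n := Fin 2 × Fin n) (𝕜 := ℂ) ρ with hT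
  have hTs : (T : EuclideanSpace ℂ (Fin 2 × Fin n) →ₗ[ℂ] _).IsSymmetric :=
    Matrix.isSymmetric_toEuclideanLin_iff.2 hρ
  let o : Fin (2 * n) := ⟨0, h0⟩
  let a : Fin (2 * n) := ⟨2 * n - 3, h3⟩
  let b : Fin (2 * n) := ⟨2 * n - 2, h2⟩
  let d : Fin (2 * n) := ⟨2 * n - 1, h1⟩
  have hinj : Function.Injective ![d, o, b, a] := by
    intro i j hij
    fin_cases i <;> fin_cases j <;> simp [o, a, b, d] at hij ⊢ <;> omega
  have hF := orthonormal_sum_sub (g.orthonormal.comp _ hinj)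
  obtain ⟨u, hu⟩ := exists_orthonormalBasis_extending (ι := Fin 2 × Fin n) (by simp) hF
    (e := ![(0, ⟨0, by omega⟩), (0, ⟨1, by omega⟩), (1, ⟨0, by omega⟩), (1, ⟨1, by omega⟩)])
    (by intro i j hij; fin_cases i <;> fin_cases j <;> simp at hij ⊢)
  obtain ⟨U, hU, hUu⟩ := inner_orthonormalBasis_toMatrix ρ u
  have key := (h U hU).norm_inner_sq_le (Matrix.isHermitian_conjTranspose_mul_mul U hρ)
    (EuclideanSpace.single ⟨0, by omega⟩ 1) (EuclideanSpace.single ⟨1, by omega⟩ 1)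
  simp only [inner_single_blockOp, hUu] at key
  have u0 := hu 0
  have u1 := hu 1
  have u2 := hu 2
  have u3 := hu 3
  simp only [Matrix.cons_val, Function.comp_apply] at u0 u1 u2 u3
  have hob : o ≠ b := by simp [o, b, Fin.ext_iff]; omega
  have eo : inner ℂ (g o) (g b) = 0 := g.orthonormal.2 hob
  have eo' : inner ℂ (g b) (g o) = 0 := g.orthonormal.2 hob.symm
  have e2 : ∀ i, inner ℂ (g i) (T (g i)) = (μ i : ℂ) := fun i => by
    rw [hg, inner_smul_right, g.inner_eq_one, mul_one]
  have hsq : ((√2)⁻¹ : ℂ) * ((√2)⁻¹ : ℂ) = 1 / 2 := by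
    rw [← mul_inv]
    norm_cast
    rw [Real.mul_self_sqrt (by norm_num)]
    simp
  have e1 : inner ℂ (((√2)⁻¹ : ℂ) • (g o + g b)) (T (((√2)⁻¹ : ℂ) • (g o - g b))) =
      (((μ o - μ b) / 2 : ℝ) : ℂ) := by
    rw [map_smul, inner_smul_left, inner_smul_right, ← mul_assoc, ← Complex.ofReal_inv,
      Complex.conj_ofReal, Complex.ofReal_inv, hsq, map_sub, hg, hg, inner_add_left,
      inner_sub_right,
      inner_sub_right, inner_smul_right, inner_smul_right, inner_smul_right, inner_smul_right,
      g.inner_eq_one, g.inner_eq_one, eo, eo']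
    push_cast
    ring
  rw [u0, u1, u2, u3, e1, e2, e2, Complex.norm_real, Real.norm_eq_abs, sq_abs, Complex.ofReal_re,
    Complex.ofReal_re] at key
  have := (le_abs_self _).trans (Real.abs_le_sqrt key)
  rw [mul_comm (μ d)] at this
  change μ o ≤ μ b + 2 * √(μ a * μ d)
  linarith

/-- The elementary tensor `e_a ⊗ ξ`. -/
noncomputable def basisTensor (a : Fin 2) (ξ : EuclideanSpace ℂ (Fin n)) :
    EuclideanSpace ℂ (Fin 2 × Fin n) :=
  WithLp.toLp 2 fun p => if p.1 = a then ξ p.2 else 0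

theorem inner_basisTensor (M : BipartiteMatrix 2 n) (a b : Fin 2)
    (x y : EuclideanSpace ℂ (Fin n)) :
    inner ℂ (basisTensor a x)
      (Matrix.toEuclideanCLM (n := Fin 2 × Fin n) (𝕜 := ℂ) M (basisTensor b y)) =
      inner ℂ x (blockOp M a b y) := by
  rw [inner_blockOp, EuclideanSpace.inner_eq_star_dotProduct, dotProduct_comm]
  simp only [Matrix.ofLp_toEuclideanCLM, dotProduct, Matrix.mulVec, Finset.mul_sum, basisTensor,
    Fintype.sum_prod_type]
  fin_cases a <;> fin_cases b <;> simp [Fin.sum_univ_two, mul_assoc]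

theorem inner_basisTensor_basisTensor (a b : Fin 2) (x y : EuclideanSpace ℂ (Fin n)) :
    inner ℂ (basisTensor a x) (basisTensor b y) = if a = b then inner ℂ x y else 0 := by
  simp only [EuclideanSpace.inner_eq_star_dotProduct, dotProduct, basisTensor,
    Fintype.sum_prod_type]
  fin_cases a <;> fin_cases b <;> simp

/-- Normalising `ξ 0 ⊥ ξ 1` to `η 0`, `η 1` makes the four vectors `e_a ⊗ η_b` orthonormal, also
after applying `U`. The form becomes the weighted one with `c = ‖ξ 0‖`, `s = ‖ξ 1‖`. -/
theorem re_sum_inner_blockOp_nonneg (hn : 2 ≤ n) (h0 : 0 < 2 * n) (h1 : 2 * n - 1 < 2 * n)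
    (h2 : 2 * n - 2 < 2 * n) (h3 : 2 * n - 3 < 2 * n) {ρ : BipartiteMatrix 2 n} (hρ : ρ.PosSemidef)
    (hcond : sortedEigenvalue hρ.isHermitian ⟨0, h0⟩ ≤
      sortedEigenvalue hρ.isHermitian ⟨2 * n - 2, h2⟩ +
      2 * √(sortedEigenvalue hρ.isHermitian ⟨2 * n - 3, h3⟩ *
        sortedEigenvalue hρ.isHermitian ⟨2 * n - 1, h1⟩))
    {U : BipartiteMatrix 2 n} (hU : U ∈ Matrix.unitaryGroup (Fin 2 × Fin n) ℂ)
    {ξ : Fin 2 → EuclideanSpace ℂ (Fin n)} (hξ : inner ℂ (ξ 0) (ξ 1) = 0) :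
    0 ≤ (∑ a, ∑ b, inner ℂ (ξ b) (blockOp (Uᴴ * ρ * U) a b (ξ a))).re := by
  have hN : (Uᴴ * ρ * U).PosSemidef := hρ.conjTranspose_mul_mul_same U
  have hpos : ∀ a z, 0 ≤ (inner ℂ z (blockOp (Uᴴ * ρ * U) a a z)).re := fun a z => by
    have := (posSemidef_block hN a).dotProduct_mulVec_nonneg z.ofLp
    rw [EuclideanSpace.inner_eq_star_dotProduct, dotProduct_comm]
    exact (Complex.le_def.1 this).1
  simp only [Fin.sum_univ_two]
  by_cases hξ0 : ξ 0 = 0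
  · simpa [hξ0] using hpos 1 (ξ 1)
  by_cases hξ1 : ξ 1 = 0
  · simpa [hξ1] using hpos 0 (ξ 0)
  obtain ⟨g, hg⟩ := exists_sorted_eigenbasis hρ.isHermitian
  set T := Matrix.toEuclideanCLM (n := Fin 2 × Fin n) (𝕜 := ℂ) ρ with hT
  set W := Matrix.toEuclideanCLM (n := Fin 2 × Fin n) (𝕜 := ℂ) U with hW
  have hTs : (T : EuclideanSpace ℂ (Fin 2 × Fin n) →ₗ[ℂ] _).IsSymmetric :=
    Matrix.isSymmetric_toEuclideanLin_iff.2 hρ.isHermitian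
  have hμ0 : ∀ i, 0 ≤ sortedEigenvalue hρ.isHermitian i := by
    intro i
    have h := hρ.dotProduct_mulVec_nonneg (g i).ofLp
    have e : star (g i).ofLp ⬝ᵥ (ρ *ᵥ (g i).ofLp) = inner ℂ (g i) (T (g i)) := by
      rw [EuclideanSpace.inner_eq_star_dotProduct, dotProduct_comm]
      rfl
    rw [e, hg, inner_smul_right, g.inner_eq_one, mul_one] at h
    exact_mod_cast h
  have hWW : ContinuousLinearMap.adjoint W ∘L W = 1 := by
    have := congrArg (Matrix.toEuclideanCLM (n := Fin 2 × Fin n) (𝕜 := ℂ))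
      (Matrix.mem_unitaryGroup_iff'.1 hU)
    rw [map_mul, map_star, map_one] at this
    exact this
  have hWi : ∀ x y, inner ℂ (W x) (W y) = inner ℂ x y := fun x y => by
    rw [← ContinuousLinearMap.adjoint_inner_right]
    exact congrArg (inner ℂ x) (DFunLike.congr_fun hWW y)
  have hNb : ∀ a b x y, inner ℂ x (blockOp (Uᴴ * ρ * U) a b y) =
      inner ℂ (W (basisTensor a x)) (T (W (basisTensor b y))) := by
    intro a b x y
    rw [← inner_basisTensor, ← ContinuousLinearMap.adjoint_inner_right]
    congr 1
    change Matrix.toEuclideanCLM (n := Fin 2 × Fin n) (𝕜 := ℂ) (star U * ρ * U) _ = _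
    rw [map_mul, map_mul, map_star]
    rfl
  let η : Fin 2 → EuclideanSpace ℂ (Fin n) := fun a => (‖ξ a‖ : ℂ)⁻¹ • ξ a
  have hξη : ∀ a, ξ a = (‖ξ a‖ : ℂ) • η a := by
    intro a
    have : (‖ξ a‖ : ℂ) ≠ 0 := by
      fin_cases a
      · exact_mod_cast norm_ne_zero_iff.2 hξ0
      · exact_mod_cast norm_ne_zero_iff.2 hξ1
    rw [smul_smul, mul_inv_cancel₀ this, one_smul]
  have hη1 : ∀ a, inner ℂ (η a) (η a) = 1 := by
    intro a
    have : ‖η a‖ = 1 := norm_smul_inv_norm (by fin_cases a <;> assumption)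
    rw [inner_self_eq_norm_sq_to_K, this]
    simp
  have hη01 : inner ℂ (η 0) (η 1) = 0 := by
    simp only [η, inner_smul_left, inner_smul_right, hξ, mul_zero]
  have hη10 : inner ℂ (η 1) (η 0) = 0 := by
    rw [← inner_conj_symm, hη01, map_zero]
  have hf : Orthonormal ℂ ![W (basisTensor 0 (η 0)), W (basisTensor 0 (η 1)),
      W (basisTensor 1 (η 0)), W (basisTensor 1 (η 1))] := by
    rw [orthonormal_iff_ite]
    intro i j
    fin_cases i <;> fin_cases j <;>
      simp [hWi, inner_basisTensor_basisTensor, hη1, hη01, hη10, -inner_self_eq_norm_sq_to_K]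
  have key := weighted_form_nonneg g hTs (sortedEigenvalue_antitone hρ.isHermitian) hμ0 hg
    (by omega) hcond hf (norm_nonneg (ξ 0)) (norm_nonneg (ξ 1))
  simp only [Matrix.cons_val] at key
  have hterm : ∀ a b, (inner ℂ (ξ b) (blockOp (Uᴴ * ρ * U) a b (ξ a))).re = ‖ξ a‖ * ‖ξ b‖ *
      (inner ℂ (W (basisTensor a (η b))) (T (W (basisTensor b (η a))))).re := by
    intro a b
    rw [hξη a, hξη b, map_smul, inner_smul_left, inner_smul_right, hNb, Complex.conj_ofReal,
      ← mul_assoc, ← Complex.ofReal_mul, Complex.re_ofReal_mul, ← hξη a, ← hξη b]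
    ring
  have hsym : (inner ℂ (W (basisTensor 1 (η 0))) (T (W (basisTensor 0 (η 1))))).re =
      (inner ℂ (W (basisTensor 0 (η 1))) (T (W (basisTensor 1 (η 0))))).re := by
    rw [← inner_conj_symm, Complex.conj_re]
    exact congrArg Complex.re (hTs _ _)
  simp only [Complex.add_re, hterm, hsym]
  linarith

theorem partialTranspose_conj_kronecker (M : BipartiteMatrix 2 n)
    (Q : Matrix (Fin 2) (Fin 2) ℂ) :
    partialTranspose ((Q ⊗ₖ (1 : Matrix (Fin n) (Fin n) ℂ))ᴴ * M *
      (Q ⊗ₖ (1 : Matrix (Fin n) (Fin n) ℂ))) =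
      (Q ⊗ₖ (1 : Matrix (Fin n) (Fin n) ℂ))ᴴ * partialTranspose M *
        (Q ⊗ₖ (1 : Matrix (Fin n) (Fin n) ℂ)) := by
  have hpt : ∀ A B C D : Matrix (Fin n) (Fin n) ℂ,
      partialTranspose (blockMatrix A B C D) = blockMatrix Aᵀ Bᵀ Cᵀ Dᵀ := by
    intro A B C D
    ext ⟨a, i⟩ ⟨b, j⟩
    fin_cases a <;> fin_cases b <;> simp [blockMatrix, partialTranspose]
  rw [← blockMatrix_block M, ← blockMatrix_smul_one, blockMatrix_conjTranspose, hpt]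
  simp only [blockMatrix_mul, hpt]
  congr 1 <;> simp

/-- A local unitary on the qubit makes the two halves of a vector orthogonal. -/
theorem exists_unitary_orthogonal_rows (ψ : Fin 2 × Fin n → ℂ) :
    ∃ Q ∈ Matrix.unitaryGroup (Fin 2) ℂ,
      ∑ i, (((Q ⊗ₖ (1 : Matrix (Fin n) (Fin n) ℂ))ᴴ *ᵥ ψ) (0, i)) *
        star (((Q ⊗ₖ (1 : Matrix (Fin n) (Fin n) ℂ))ᴴ *ᵥ ψ) (1, i)) = 0 := by
  let Ψ : Matrix (Fin 2) (Fin n) ℂ := Matrix.of fun a i => ψ (a, i)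
  have hG : (Ψ * Ψᴴ).IsHermitian := Matrix.isHermitian_mul_conjTranspose_self Ψ
  -- Diagonalising the 2 × 2 Gram matrix of the two halves makes them orthogonal: the Schmidt
  -- decomposition.
  let Q : Matrix (Fin 2) (Fin 2) ℂ := hG.eigenvectorUnitary
  refine ⟨Q, hG.eigenvectorUnitary.2, ?_⟩
  have hrow : ∀ a i, ((Q ⊗ₖ (1 : Matrix (Fin n) (Fin n) ℂ))ᴴ *ᵥ ψ) (a, i) = (Qᴴ * Ψ) a i := by
    intro a i
    rw [Matrix.conjTranspose_kronecker]
    simp [Matrix.mulVec, dotProduct, Matrix.mul_apply, Fintype.sum_prod_type, Matrix.one_apply, Ψ]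
  simp_rw [hrow]
  have h1 : ∑ i, (Qᴴ * Ψ) 0 i * star ((Qᴴ * Ψ) 1 i) = (Qᴴ * (Ψ * Ψᴴ) * Q) 0 1 := by
    have : Qᴴ * (Ψ * Ψᴴ) * Q = (Qᴴ * Ψ) * (Qᴴ * Ψ)ᴴ := by
      simp [Matrix.conjTranspose_mul, mul_assoc, Matrix.mul_assoc]
    rw [this, Matrix.mul_apply]
    rfl
  have h2 := hG.conjStarAlgAut_star_eigenvectorUnitary
  rw [Unitary.conjStarAlgAut_apply] at h2
  have h3 : Qᴴ * (Ψ * Ψᴴ) * Q = Matrix.diagonal (RCLike.ofReal ∘ hG.eigenvalues) := by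
    rw [← h2]
    simp [Q, Matrix.star_eq_conjTranspose]
  rw [h1, h3]
  simp

/-- Partial transposition acts on the second factor and commutes with conjugation by `Q ⊗ 1`.
Replacing `U` by `U(Q ⊗ 1)` therefore reduces any test vector to one with orthogonal halves. -/
theorem isPPTFromSpectrum_of_sortedEigenvalue_le (hn : 2 ≤ n) (h0 : 0 < 2 * n)
    (h1 : 2 * n - 1 < 2 * n)
    (h2 : 2 * n - 2 < 2 * n) (h3 : 2 * n - 3 < 2 * n) {ρ : BipartiteMatrix 2 n}
    (hρ : ρ.PosSemidef)
    (hcond : sortedEigenvalue hρ.isHermitian ⟨0, h0⟩ ≤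
      sortedEigenvalue hρ.isHermitian ⟨2 * n - 2, h2⟩ +
      2 * √(sortedEigenvalue hρ.isHermitian ⟨2 * n - 3, h3⟩ *
        sortedEigenvalue hρ.isHermitian ⟨2 * n - 1, h1⟩)) :
    IsPPTFromSpectrum ρ := by
  intro U hU
  have hNh := Matrix.isHermitian_conjTranspose_mul_mul U hρ.isHermitian
  have hPh := partialTranspose_isHermitian hNh
  refine .of_dotProduct_mulVec_nonneg hPh fun ψ => ?_
  refine Complex.le_def.2 ⟨?_, (hPh.im_star_dotProduct_mulVec_self ψ).symm⟩
  obtain ⟨Q, hQ, hQψ⟩ := exists_unitary_orthogonal_rows ψ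
  set R := Q ⊗ₖ (1 : Matrix (Fin n) (Fin n) ℂ) with hR
  have hRu : R ∈ Matrix.unitaryGroup (Fin 2 × Fin n) ℂ :=
    Matrix.kronecker_mem_unitary hQ (one_mem _)
  set φ := Rᴴ *ᵥ ψ with hφ
  have hψφ : ψ = R *ᵥ φ := by
    rw [hφ, Matrix.mulVec_mulVec]
    have : R * Rᴴ = 1 := Matrix.mem_unitaryGroup_iff.1 hRu
    rw [this, Matrix.one_mulVec]
  have hform : star ψ ⬝ᵥ (partialTranspose (Uᴴ * ρ * U) *ᵥ ψ) =
      star φ ⬝ᵥ (partialTranspose ((U * R)ᴴ * ρ * (U * R)) *ᵥ φ) := by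
    have : (U * R)ᴴ * ρ * (U * R) = Rᴴ * (Uᴴ * ρ * U) * R := by
      simp [Matrix.conjTranspose_mul, mul_assoc]
    rw [this, hR, partialTranspose_conj_kronecker, ← hR]
    conv_lhs => rw [hψφ]
    rw [Matrix.star_mulVec, ← Matrix.dotProduct_mulVec, Matrix.mulVec_mulVec,
      Matrix.mulVec_mulVec, mul_assoc]
  rw [hform]
  let ξ : Fin 2 → EuclideanSpace ℂ (Fin n) := fun a => WithLp.toLp 2 fun i => star (φ (a, i))
  have hξ : inner ℂ (ξ 0) (ξ 1) = 0 := by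
    rw [EuclideanSpace.inner_eq_star_dotProduct, ← hQψ]
    simp only [dotProduct, ξ, Pi.star_apply, star_star]
    exact Finset.sum_congr rfl fun i _ => mul_comm _ _
  have e : (fun p : Fin 2 × Fin n => star (ξ p.1 p.2)) = φ := by
    ext p
    simp [ξ]
  have := re_sum_inner_blockOp_nonneg hn h0 h1 h2 h3 hρ hcond (mul_mem hU hRu) hξ
  rw [← star_dotProduct_partialTranspose] at this
  simp only [e] at this
  exact this

end PartialTransposeFromSpectrum

/-! ### The equivalence -/

theorem IsSeparableState.isPPT {m n : ℕ} {ρ : BipartiteMatrix m n} (h : IsSeparableState ρ) :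
    IsPPT ρ := by
  obtain ⟨k, p, v, w, hp, -, -, -, rfl⟩ := h
  have : partialTranspose (∑ i, (p i : ℂ) • (ketbra (v i) ⊗ₖ ketbra (w i))) =
      ∑ i, (p i : ℂ) • (ketbra (v i) ⊗ₖ (ketbra (w i))ᵀ) := by
    ext a b
    simp [partialTranspose, Matrix.sum_apply]
  rw [IsPPT, this]
  refine Matrix.posSemidef_sum _ fun i _ => Matrix.PosSemidef.smul ?_ ?_
  · exact (Matrix.posSemidef_vecMulVec_self_star _).kronecker
      (Matrix.posSemidef_vecMulVec_self_star _).transpose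
  · exact_mod_cast hp i

theorem theorem1 (n : ℕ) (hn : 2 ≤ n) (ρ : BipartiteMatrix 2 n) (hρ : IsState ρ) :
    List.TFAE [
      IsSeparableFromSpectrum ρ,
      IsPPTFromSpectrum ρ,
      sortedEigenvalue hρ.1.isHermitian ⟨0, by omega⟩ ≤
        sortedEigenvalue hρ.1.isHermitian ⟨2 * n - 2, by omega⟩ +
          2 * Real.sqrt (sortedEigenvalue hρ.1.isHermitian ⟨2 * n - 3, by omega⟩ *
            sortedEigenvalue hρ.1.isHermitian ⟨2 * n - 1, by omega⟩)] := by
  tfae_have 1 → 2 := fun h U hU => (h U hU).isPPT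
  tfae_have 2 → 3 := sortedEigenvalue_le_of_isPPTFromSpectrum hn (by omega) (by omega)
    (by omega) (by omega) hρ.1.isHermitian
  tfae_have 3 → 2 := isPPTFromSpectrum_of_sortedEigenvalue_le hn (by omega) (by omega)
    (by omega) (by omega) hρ.1
  -- PPT from spectrum is invariant under unitary conjugation, so it suffices that such a state is
  -- itself separable.
  tfae_have 2 → 1 := fun h U hU => by
    refine isSeparableState_of_mem_separableCone (mem_separableCone_of_isPPTFromSpectrum (by omega)
      (hρ.1.conjTranspose_mul_mul_same U) (h.conj hU)) ?_
    have hUU : U * Uᴴ = 1 := Matrix.mem_unitaryGroup_iff.1 hU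
    rw [Matrix.trace_mul_comm, ← mul_assoc, hUU, one_mul, hρ.2]
  tfae_finish
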